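/- A plane quartic is a curve $Q=\{F=0\}\subset\mathbb P^2=\mathbb P^2(\mathbb C)$ with $F\in\mathbb C[x,y,z]$ nonzero and homogeneous of degree $4$, taken up to a nonzero scalar. A node is a double point with two distinct tangent lines; an ordinary cusp is a double point with a single (double) tangent line, which meets $Q$ there with multiplicity exactly $3$; a flex point is a smooth point of $Q$ whose tangent line meets $Q$ there with multiplicity at least $3$. Theorem. Up to projective equivalence there is a unique plane quartic $Q$ that contains distinct points $p_1,\dots,p_7$ such that: (1) $Q$ has a node at $p_1$ and ordinary cusps at $p_2$ and $p_3$; (2) $p_4$ and $p_5$ are flex points of $Q$; (3) the tangent lines to $Q$ at $p_4$ and $p_5$ contain $p_6$ and $p_7$, respectively; (4) the line through $p_6$ and $p_7$ contains $p_1$. More precisely, for every such $(Q;p_1,\dots,p_7)$ there is a projective transformation of $\mathbb P^2$ after which $$p_1=[0:0:1],\quad p_2=[0:1:1],\quad p_3=[1:0:1],$$ $Q$ has the equation $$(x^2+xy+y^2-xz-yz)^2-8xy(x+y-z)^2=0,$$ and, for one of the two square roots $r$ of $-2$, $$p_4=[8+2r:8-2r:25],\quad p_5=[8-2r:8+2r:25],\quad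 p_6=[-2r:2r:1],\quad p_7=[2r:-2r:1].$$ Conversely, for either square root $r$ of $-2$, this curve with these seven points satisfies (1)–(4). -/

import Mathlib

open scoped LinearAlgebra.Projectivization

noncomputable section

namespace PlaneQuartic

/-- The complex projective plane. -/
abbrev Plane : Type := ℙ ℂ (Fin 3 → ℂ)

/-- Polynomials in the homogeneous coordinates `x = X 0`, `y = X 1`, `z = X 2`. -/
abbrev Form : Type := MvPolynomial (Fin 3) ℂ

/-- `F` is an equation of a plane quartic curve. The curve is `F` up to a nonzero scalar.
All the predicates below, for such an `F`, depend neither on this scalar nor on the chosen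
representative vectors of the points. -/
def IsQuartic (F : Form) : Prop := F ≠ 0 ∧ F.IsHomogeneous 4

/-- The point `p` lies on the curve `F = 0`. -/
def OnCurve (F : Form) (p : Plane) : Prop := MvPolynomial.eval p.rep F = 0

/-- The value at `p` of the partial derivative of `F` with respect to the `i`-th coordinate. -/
def partialAt (F : Form) (p : Plane) (i : Fin 3) : ℂ :=
  MvPolynomial.eval p.rep (MvPolynomial.pderiv i F)

/-- `p` is a smooth point of the curve `F = 0`. -/
def IsSmoothPoint (F : Form) (p : Plane) : Prop :=
  OnCurve F p ∧ ∃ i, partialAt F p i ≠ 0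

/-- `p` is a singular point of the curve `F = 0`. -/
def IsSingularPoint (F : Form) (p : Plane) : Prop :=
  OnCurve F p ∧ ∀ i, partialAt F p i = 0

/-- `q` lies on the tangent line to `F = 0` at `p` (meaningful if `p` is a smooth point). -/
def OnTangentLine (F : Form) (p q : Plane) : Prop :=
  ∑ i, partialAt F p i * q.rep i = 0

/-- The intersection multiplicity at `p` of the curve `F = 0` with the line through the distinct
points `p` and `q`: the order of vanishing at `t = 0` of `F (p + t q)`. It is `⊤` if the line is
contained in the curve. -/
def lineMult (F : Form) (p q : Plane) : ℕ∞ :=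
  emultiplicity (Polynomial.X : Polynomial ℂ)
    (MvPolynomial.aeval
      (fun i => Polynomial.C (p.rep i) + Polynomial.X * Polynomial.C (q.rep i)) F)

/-- The quadratic form `w ↦ ∑ ∂ᵢ∂ⱼF(p) wᵢ wⱼ`. At a singular point `p` of `F = 0` it is, up to
the factor `2`, the degree two part of the Taylor expansion of `F` at `p`; at a double point
its zero locus is the tangent cone. -/
def quadraticPart (F : Form) (p : Plane) (w : Fin 3 → ℂ) : ℂ :=
  ∑ i, ∑ j,
    MvPolynomial.eval p.rep (MvPolynomial.pderiv i (MvPolynomial.pderiv j F)) * w i * w j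

/-- A node (ordinary double point): a double point whose tangent cone consists of two distinct
lines. -/
def IsNode (F : Form) (p : Plane) : Prop :=
  IsSingularPoint F p ∧
    ∃ l m : Module.Dual ℂ (Fin 3 → ℂ), LinearIndependent ℂ ![l, m] ∧
      ∀ w, quadraticPart F p w = l w * m w

/-- An ordinary cusp: a double point whose tangent cone is a double line, this line meeting the
curve at the point with intersection multiplicity exactly three. -/
def IsOrdinaryCusp (F : Form) (p : Plane) : Prop :=
  IsSingularPoint F p ∧
    ∃ l : Module.Dual ℂ (Fin 3 → ℂ), l ≠ 0 ∧
      (∀ w, quadraticPart F p w = l w ^ 2) ∧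
      ∀ q : Plane, q ≠ p → l q.rep = 0 → lineMult F p q = 3

/-- A flex point: a smooth point at which the tangent line meets the curve with intersection
multiplicity at least three. -/
def IsFlex (F : Form) (p : Plane) : Prop :=
  IsSmoothPoint F p ∧ ∀ q : Plane, q ≠ p → OnTangentLine F p q → 3 ≤ lineMult F p q

/-- The quartic `F = 0` with the points `p₁, …, p₇` (here `p 0, …, p 6`): a node `p₁`, ordinary
cusps `p₂, p₃`, flex points `p₄, p₅`, and points `p₆, p₇` of the curve on the tangent lines at
`p₄, p₅` such that `p₁, p₆, p₇` are collinear. -/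
structure IsConfiguration (F : Form) (p : Fin 7 → Plane) : Prop where
  quartic : IsQuartic F
  distinct : Function.Injective p
  node : IsNode F (p 0)
  cusp₂ : IsOrdinaryCusp F (p 1)
  cusp₃ : IsOrdinaryCusp F (p 2)
  flex₄ : IsFlex F (p 3)
  flex₅ : IsFlex F (p 4)
  mem₆ : OnCurve F (p 5)
  mem₇ : OnCurve F (p 6)
  tangent₄ : OnTangentLine F (p 3) (p 5)
  tangent₅ : OnTangentLine F (p 4) (p 6)
  collinear : Projectivization.Dependent ![p 0, p 5, p 6]

/-- The projective transformation given by `T` maps the curve `F = 0` onto the curve `G = 0`: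
`G ∘ T` and `F` agree up to a nonzero scalar. -/
def MapsCurve (T : (Fin 3 → ℂ) ≃ₗ[ℂ] (Fin 3 → ℂ)) (F G : Form) : Prop :=
  ∃ c : ℂ, c ≠ 0 ∧
    MvPolynomial.bind₁ (LinearMap.toMatrix' T.toLinearMap).toMvPolynomial G = c • F

/-- Projective equivalence of plane curves. -/
def ProjectivelyEquivalent (F G : Form) : Prop :=
  ∃ T : (Fin 3 → ℂ) ≃ₗ[ℂ] (Fin 3 → ℂ), MapsCurve T F G

/-- The form `(x² + xy + y² - xz - yz)² - 8xy(x + y - z)²`. -/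
def stdQuartic : Form :=
  let x : Form := MvPolynomial.X 0
  let y : Form := MvPolynomial.X 1
  let z : Form := MvPolynomial.X 2
  (x ^ 2 + x * y + y ^ 2 - x * z - y * z) ^ 2 - 8 * x * y * (x + y - z) ^ 2

/-- Homogeneous coordinates of the seven points; `r` is a square root of `-2`. -/
def stdCoords (r : ℂ) : Fin 7 → Fin 3 → ℂ :=
  ![![0, 0, 1],
    ![0, 1, 1],
    ![1, 0, 1],
    ![8 + 2 * r, 8 - 2 * r, 25],
    ![8 - 2 * r, 8 + 2 * r, 25],
    ![-2 * r, 2 * r, 1],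
    ![2 * r, -2 * r, 1]]

theorem stdCoords_ne_zero (r : ℂ) (i : Fin 7) : stdCoords r i ≠ 0 := by
  intro h
  have h2 := congrFun h 2
  fin_cases i <;> simp [stdCoords] at h2

/-- The seven points with coordinates `stdCoords r`. -/
def stdPoints (r : ℂ) (i : Fin 7) : Plane :=
  Projectivization.mk ℂ (stdCoords r i) (stdCoords_ne_zero r i)

end PlaneQuartic

end

/-!
In coordinates with the node at `[1:0:0]` and the cusps at `[0:1:0]` and `[0:0:1]`, suitably
rescaled, the quartic is `(xy + xz + yz)² = k x²yz`, where `k ≠ 0, 4` because the double point is a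
node. Write `k = κ²`. The curve is then rational, with parameter `m = (xy + xz + yz) / (κxz)`:

* its flexes are given by the two roots of `3κm² - (8 + κ²)m + 3κ`;
* the tangent at the flex with parameter `m` meets the curve again at the parameter `κ - 3m`;
* a line through the node meets the curve again at opposite parameters.

Hence the collinearity condition on two flexes `m ≠ n` is `κ - 3m = -(κ - 3n)`. Together with
`m + n = (8 + κ²) / (3κ)` it forces `κ² = 8`, and the flexes are then determined up to their order,
which is the choice of a square root of `-2`.
-/

noncomputable section

namespace PlaneQuartic

section Along

variable {R σ : Type*} [CommSemiring R]

/-- The restriction `F (v + t w)` of a polynomial to the line through `v` in direction `w`, as a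
polynomial in `t`. Its coefficients encode the local behaviour of the curve `F = 0` at `v`. -/
def along (F : MvPolynomial σ R) (v w : σ → R) : Polynomial R :=
  MvPolynomial.aeval (fun i => Polynomial.C (v i) + Polynomial.X * Polynomial.C (w i)) F

theorem eval_along (F : MvPolynomial σ R) (v w : σ → R) (t : R) :
    (along F v w).eval t = MvPolynomial.eval (v + t • w) F := by
  induction F using MvPolynomial.induction_on with
  | C a => simp [along]
  | add p q hp hq => simp_all [along]
  | mul_X p i hp => simp_all [along, mul_comm t]

theorem coeff_zero_along (F : MvPolynomial σ R) (v w : σ → R) :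
    (along F v w).coeff 0 = MvPolynomial.eval v F := by
  rw [Polynomial.coeff_zero_eq_eval_zero, eval_along, zero_smul, add_zero]

theorem coeff_along_smul_right (F : MvPolynomial σ R) (v w : σ → R) (b : R) (k : ℕ) :
    (along F v (b • w)).coeff k = b ^ k * (along F v w).coeff k := by
  have h : along F v (b • w) = (along F v w).comp (Polynomial.C b * Polynomial.X) := by
    induction F using MvPolynomial.induction_on with
    | C a => simp [along]
    | add p q hp hq => simp_all [along]
    | mul_X p i hp =>
      simp only [along, map_mul, Polynomial.mul_comp, MvPolynomial.aeval_X] at hp ⊢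
      rw [hp]
      simp
      ring
  rw [h, Polynomial.comp_C_mul_X_coeff, mul_comm]

theorem eval_smul_of_isHomogeneous {F : MvPolynomial σ R} {n : ℕ} (hF : F.IsHomogeneous n)
    (a : R) (v : σ → R) :
    MvPolynomial.eval (a • v) F = a ^ n * MvPolynomial.eval v F := by
  rw [MvPolynomial.eval_eq, MvPolynomial.eval_eq, Finset.mul_sum]
  refine Finset.sum_congr rfl fun d hd => ?_
  simp only [Pi.smul_apply, smul_eq_mul, mul_pow, Finset.prod_mul_distrib,
    Finset.prod_pow_eq_pow_sum, hF.degree_eq_sum_deg_support hd]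
  ring

theorem natDegree_along_le {F : MvPolynomial σ R} {n : ℕ} (hF : F.IsHomogeneous n) (v w : σ → R) :
    (along F v w).natDegree ≤ n := by
  have h := MvPolynomial.aeval_natDegree_le F hF.totalDegree_le
    (fun i => Polynomial.C (v i) + Polynomial.X * Polynomial.C (w i)) (n := 1)
    fun i => by compute_degree
  rwa [mul_one] at h

/-- `F (w + t v) = t ^ n F (v + t⁻¹ w)`. -/
theorem coeff_along_swap {K : Type*} [Field K] [Infinite K] {F : MvPolynomial σ K}
    {n : ℕ} (hF : F.IsHomogeneous n) (v w : σ → K) {k : ℕ} (hk : k ≤ n) :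
    (along F w v).coeff k = (along F v w).coeff (n - k) := by
  have h : along F w v = (along F v w).reflect n := by
    refine Polynomial.eq_of_infinite_eval_eq _ _ ((Set.finite_singleton 0).infinite_compl.mono ?_)
    intro t ht
    have := invertibleOfNonzero (inv_ne_zero ht)
    have reflect_eval := Polynomial.eval₂_reflect_mul_pow (RingHom.id K) t⁻¹ n (along F v w)
      (natDegree_along_le hF v w)
    simp only [invOf_eq_inv, inv_inv, Polynomial.eval₂_id, eval_along] at reflect_eval
    have ht' : t ≠ 0 := ht
    have smul_line : w + t • v = t • (v + t⁻¹ • w) := by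
      rw [smul_add, smul_inv_smul₀ ht', add_comm]
    change (along F w v).eval t = ((along F v w).reflect n).eval t
    rw [eval_along, smul_line, eval_smul_of_isHomogeneous hF, ← reflect_eval, inv_pow, mul_comm,
      inv_mul_cancel_right₀ (pow_ne_zero n ht')]
  rw [h, Polynomial.coeff_reflect, Polynomial.revAt_le hk]

variable [Fintype σ]

theorem derivative_along (F : MvPolynomial σ R) (v w : σ → R) :
    Polynomial.derivative (along F v w) =
      ∑ i, Polynomial.C (w i) * along (MvPolynomial.pderiv i F) v w := by
  classical
  induction F using MvPolynomial.induction_on with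
  | C a => simp [along]
  | add p q hp hq => simp_all [along, mul_add, Finset.sum_add_distrib]
  | mul_X p i hp =>
    have leibniz (j : σ) : along (MvPolynomial.pderiv j (p * MvPolynomial.X i)) v w =
        (if i = j then along p v w else 0) +
          along (MvPolynomial.pderiv j p) v w * along (MvPolynomial.X i) v w := by
      rw [MvPolynomial.pderiv_mul, MvPolynomial.pderiv_X, Pi.single_apply]
      split_ifs <;> simp [along, add_comm]
    have derivative_X : Polynomial.derivative (along (MvPolynomial.X i) v w) =
        Polynomial.C (w i) := by
      simp [along]
    have along_mul : along (p * MvPolynomial.X i) v w =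
        along p v w * along (MvPolynomial.X i) v w := map_mul _ _ _
    simp only [leibniz, along_mul, Polynomial.derivative_mul, derivative_X, hp, mul_add,
      Finset.sum_add_distrib, Finset.sum_mul, mul_ite, mul_zero, Finset.sum_ite_eq,
      Finset.mem_univ, if_true, mul_assoc]
    rw [add_comm, mul_comm (along p v w)]

theorem coeff_one_along (F : MvPolynomial σ R) (v w : σ → R) :
    (along F v w).coeff 1 = ∑ i, MvPolynomial.eval v (MvPolynomial.pderiv i F) * w i := by
  have h := Polynomial.coeff_derivative (along F v w) 0
  simp only [derivative_along, Polynomial.finsetSum_coeff, Polynomial.coeff_C_mul,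
    coeff_zero_along] at h
  simpa [mul_comm] using h.symm

theorem two_mul_coeff_two_along (F : MvPolynomial σ R) (v w : σ → R) :
    2 * (along F v w).coeff 2 =
      ∑ i, ∑ j, MvPolynomial.eval v (MvPolynomial.pderiv i (MvPolynomial.pderiv j F)) *
        w i * w j := by
  have h := Polynomial.coeff_derivative (along F v w) 1
  simp only [derivative_along, Polynomial.finsetSum_coeff, Polynomial.coeff_C_mul,
    coeff_one_along, Finset.mul_sum] at h
  rw [Finset.sum_comm, mul_comm]
  norm_num at h
  rw [← h]
  exact Finset.sum_congr rfl fun i _ => Finset.sum_congr rfl fun j _ => mul_comm _ _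

end Along

section LocalTypes

variable {K σ : Type*} [Field K] {F : MvPolynomial σ K} {v w s : σ → K}

/-- `F` vanishes to order at least two at the vector `v`. -/
def SingularAt (F : MvPolynomial σ K) (v : σ → K) : Prop :=
  MvPolynomial.eval v F = 0 ∧ ∀ w, (along F v w).coeff 1 = 0

/-- Vector version of `IsNode`, formulated with the restrictions of `F` to lines through `v`. -/
def NodeAt (F : MvPolynomial σ K) (v : σ → K) : Prop :=
  SingularAt F v ∧ ∃ l m : Module.Dual K (σ → K), LinearIndependent K ![l, m] ∧
    ∀ w, (along F v w).coeff 2 = l w * m w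

/-- Vector version of `IsOrdinaryCusp`, formulated with the restrictions of `F` to lines through
`v`. The scalar `a` makes the notion independent of the existence of square roots. -/
def CuspAt (F : MvPolynomial σ K) (v : σ → K) : Prop :=
  SingularAt F v ∧ ∃ a : K, ∃ l : Module.Dual K (σ → K), a ≠ 0 ∧ l ≠ 0 ∧
    (∀ w, (along F v w).coeff 2 = a * l w ^ 2) ∧
    ∀ w, LinearIndependent K ![v, w] → l w = 0 → (along F v w).coeff 3 ≠ 0

/-- Vector version of `IsFlex`, formulated with the restrictions of `F` to lines through `v`. -/
def FlexAt (F : MvPolynomial σ K) (v : σ → K) : Prop :=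
  MvPolynomial.eval v F = 0 ∧ (∃ w, (along F v w).coeff 1 ≠ 0) ∧
    ∀ w, LinearIndependent K ![v, w] → (along F v w).coeff 1 = 0 → (along F v w).coeff 2 = 0

variable [Infinite K]

theorem SingularAt.along_eq (hF : F.IsHomogeneous 4) (hv : SingularAt F v)
    (hw : SingularAt F w) :
    along F v w = Polynomial.C ((along F v w).coeff 2) * Polynomial.X ^ 2 := by
  ext k
  rw [Polynomial.coeff_C_mul_X_pow]
  split_ifs with hk
  · rw [hk]
  · rcases le_or_gt k 4 with hk4 | hk4
    · interval_cases k
      · rw [coeff_zero_along, hv.1]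
      · exact hv.2 w
      · exact absurd rfl hk
      · rw [coeff_along_swap hF w v (by norm_num), hw.2]
      · rw [coeff_along_swap hF w v le_rfl, coeff_zero_along, hw.1]
    · exact Polynomial.coeff_eq_zero_of_natDegree_lt ((natDegree_along_le hF v w).trans_lt hk4)

/-- A line joining two singular points meets the quartic at most twice at each of them, so it is not
the cuspidal tangent. -/
theorem CuspAt.coeff_two_along_ne_zero (hF : F.IsHomogeneous 4) (hv : CuspAt F v)
    (hw : SingularAt F w) (hvw : LinearIndependent K ![v, w]) : (along F v w).coeff 2 ≠ 0 := by
  obtain ⟨hsing, a, l, ha, -, hquad, hcubic⟩ := hv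
  intro h
  have hl : l w = 0 := by simpa [hquad, ha] using h
  refine hcubic w hvw hl ?_
  rw [hsing.along_eq hF hw, h, Polynomial.C_0, zero_mul, Polynomial.coeff_zero]

theorem CuspAt.linearIndependent (hF : F.IsHomogeneous 4) (hv : CuspAt F v)
    (hw : SingularAt F w) (hs : MvPolynomial.eval s F = 0) (hvw : LinearIndependent K ![v, w])
    (hvs : LinearIndependent K ![v, s]) (hws : LinearIndependent K ![w, s]) :
    LinearIndependent K ![s, v, w] := by
  have hnotMem : s ∉ Submodule.span K (Set.range ![v, w]) := by
    rw [Matrix.range_cons, Matrix.range_cons, Matrix.range_empty, Set.union_empty,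
      Set.singleton_union, Submodule.mem_span_pair]
    rintro ⟨a, b, rfl⟩
    have ha : a ≠ 0 := by
      rintro rfl
      exact (LinearIndependent.pair_iff' (hws.ne_zero 0)).1 hws b (by simp)
    have hb : b ≠ 0 := by
      rintro rfl
      exact (LinearIndependent.pair_iff' (hvs.ne_zero 0)).1 hvs a (by simp)
    have hline : a • v + b • w = a • (v + (b / a) • w) := by
      rw [smul_add, smul_smul, mul_div_cancel₀ _ ha]
    rw [hline, eval_smul_of_isHomogeneous hF, ← eval_along, hv.1.along_eq hF hw] at hs
    simp [ha, hb, hv.coeff_two_along_ne_zero hF hw hvw] at hs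
  exact linearIndependent_finCons.2 ⟨hvw, hnotMem⟩

end LocalTypes

section MapsCurve

variable {T U : (Fin 3 → ℂ) ≃ₗ[ℂ] (Fin 3 → ℂ)} {F G H : Form} {n : ℕ} {v : Fin 3 → ℂ}

theorem eval_bind₁_toMvPolynomial (T : (Fin 3 → ℂ) ≃ₗ[ℂ] (Fin 3 → ℂ)) (G : Form)
    (v : Fin 3 → ℂ) :
    MvPolynomial.eval v (MvPolynomial.bind₁ (LinearMap.toMatrix' T.toLinearMap).toMvPolynomial G) =
      MvPolynomial.eval (T v) G := by
  have h : (fun i => MvPolynomial.eval v ((LinearMap.toMatrix' T.toLinearMap).toMvPolynomial i)) =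
      T v := by
    ext i
    rw [Matrix.toMvPolynomial_eval_eq_apply, LinearMap.toMatrix'_mulVec]
    rfl
  rw [← h]
  exact MvPolynomial.eval₂Hom_bind₁ _ _ _ _

theorem mapsCurve_iff :
    MapsCurve T F G ↔
      ∃ c : ℂ, c ≠ 0 ∧ ∀ v, MvPolynomial.eval (T v) G = c * MvPolynomial.eval v F := by
  simp only [MapsCurve, MvPolynomial.funext_iff, eval_bind₁_toMvPolynomial,
    MvPolynomial.smul_eval]

theorem MapsCurve.symm (h : MapsCurve T F G) : MapsCurve T.symm G F := by
  obtain ⟨c, hc, h⟩ := mapsCurve_iff.1 h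
  refine mapsCurve_iff.2 ⟨c⁻¹, inv_ne_zero hc, fun v => ?_⟩
  rw [← T.apply_symm_apply v, h, T.apply_symm_apply, inv_mul_cancel_left₀ hc]

theorem MapsCurve.trans (h : MapsCurve T F G) (h' : MapsCurve U G H) :
    MapsCurve (T.trans U) F H := by
  obtain ⟨c, hc, h⟩ := mapsCurve_iff.1 h
  obtain ⟨d, hd, h'⟩ := mapsCurve_iff.1 h'
  refine mapsCurve_iff.2 ⟨d * c, mul_ne_zero hd hc, fun v => ?_⟩
  rw [LinearEquiv.trans_apply, h', h, mul_assoc]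

theorem mapsCurve_smulOfNeZero (hF : F.IsHomogeneous n) {a : ℂ} (ha : a ≠ 0) :
    MapsCurve (LinearEquiv.smulOfNeZero ℂ (Fin 3 → ℂ) a ha) F F :=
  mapsCurve_iff.2 ⟨a ^ n, pow_ne_zero n ha, fun v => eval_smul_of_isHomogeneous hF a v⟩

theorem exists_mapsCurve (T : (Fin 3 → ℂ) ≃ₗ[ℂ] (Fin 3 → ℂ)) (F : Form) :
    ∃ G, MapsCurve T F G :=
  ⟨MvPolynomial.bind₁ (LinearMap.toMatrix' T.symm.toLinearMap).toMvPolynomial F,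
    mapsCurve_iff.2 ⟨1, one_ne_zero, fun v => by
      rw [eval_bind₁_toMvPolynomial, T.symm_apply_apply, one_mul]⟩⟩

theorem MapsCurve.isHomogeneous (h : MapsCurve T F G) (hF : F.IsHomogeneous n) :
    G.IsHomogeneous n := by
  obtain ⟨c, hc, hsymm⟩ := h.symm
  have hbind := hF.aeval _ (Matrix.toMvPolynomial_isHomogeneous
    (LinearMap.toMatrix' T.symm.toLinearMap))
  have hG : G = MvPolynomial.C c⁻¹ * (c • G) := by
    rw [← MvPolynomial.smul_eq_C_mul, inv_smul_smul₀ hc]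
  rw [hG, ← hsymm, ← zero_add n, ← one_mul n]
  exact (MvPolynomial.isHomogeneous_C _ _).mul hbind

theorem MapsCurve.ne_zero (h : MapsCurve T F G) (hF : F ≠ 0) : G ≠ 0 := by
  obtain ⟨c, hc, h⟩ := h
  rintro rfl
  rw [map_zero] at h
  exact smul_ne_zero hc hF h.symm

theorem MapsCurve.isQuartic (h : MapsCurve T F G) (hF : IsQuartic F) : IsQuartic G :=
  ⟨h.ne_zero hF.1, h.isHomogeneous hF.2⟩

theorem MapsCurve.exists_coeff_along (h : MapsCurve T F G) :
    ∃ c : ℂ, c ≠ 0 ∧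
      ∀ v w k, (along G (T v) (T w)).coeff k = c * (along F v w).coeff k := by
  obtain ⟨c, hc, h⟩ := mapsCurve_iff.1 h
  refine ⟨c, hc, fun v w k => ?_⟩
  rw [← Polynomial.coeff_C_mul]
  congr 1
  refine Polynomial.funext fun t => ?_
  rw [Polynomial.eval_mul, Polynomial.eval_C, eval_along, eval_along, ← h, map_add, map_smul]

theorem MapsCurve.eval_eq_zero_iff (h : MapsCurve T F G) :
    MvPolynomial.eval (T v) G = 0 ↔ MvPolynomial.eval v F = 0 := by
  obtain ⟨c, hc, h⟩ := mapsCurve_iff.1 h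
  rw [h, mul_eq_zero_iff_left hc]

theorem MapsCurve.coeff_along_eq_zero_iff (h : MapsCurve T F G) (v w : Fin 3 → ℂ) (k : ℕ) :
    (along G (T v) (T w)).coeff k = 0 ↔ (along F v w).coeff k = 0 := by
  obtain ⟨c, hc, h⟩ := h.exists_coeff_along
  rw [h, mul_eq_zero_iff_left hc]

theorem linearIndependent_pair_map_iff {K V W : Type*} [Field K] [AddCommGroup V] [Module K V]
    [AddCommGroup W] [Module K W] (T : V ≃ₗ[K] W) (v w : V) :
    LinearIndependent K ![T v, T w] ↔ LinearIndependent K ![v, w] := by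
  have h : ![T v, T w] = T ∘ ![v, w] := by ext i : 1; fin_cases i <;> rfl
  rw [h]
  exact T.toLinearMap.linearIndependent_iff T.ker

theorem SingularAt.map (h : MapsCurve T F G) (hv : SingularAt F v) : SingularAt G (T v) := by
  refine ⟨h.eval_eq_zero_iff.2 hv.1, T.surjective.forall.2 fun w => ?_⟩
  exact (h.coeff_along_eq_zero_iff v w 1).2 (hv.2 w)

theorem NodeAt.map (h : MapsCurve T F G) (hv : NodeAt F v) : NodeAt G (T v) := by
  obtain ⟨hsing, l, m, hlm, hquad⟩ := hv
  obtain ⟨c, hc, hcoeff⟩ := h.exists_coeff_along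
  refine ⟨hsing.map h, T.symm.dualMap (c • l), T.symm.dualMap m, ?_,
    T.surjective.forall.2 fun w => ?_⟩
  · rw [linearIndependent_pair_map_iff]
    simpa using (LinearIndependent.pair_smul_smul_iff hc.isUnit isUnit_one).2 hlm
  · rw [hcoeff, hquad]
    simp [mul_assoc]

theorem CuspAt.map (h : MapsCurve T F G) (hv : CuspAt F v) : CuspAt G (T v) := by
  obtain ⟨hsing, a, l, ha, hl, hquad, hcubic⟩ := hv
  obtain ⟨c, hc, hcoeff⟩ := h.exists_coeff_along
  refine ⟨hsing.map h, c * a, T.symm.dualMap l, mul_ne_zero hc ha,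
    (LinearEquiv.map_ne_zero_iff _).2 hl, T.surjective.forall.2 fun w => ?_,
    T.surjective.forall.2 fun w => ?_⟩
  · rw [hcoeff, hquad, LinearEquiv.dualMap_apply, T.symm_apply_apply, mul_assoc]
  · rw [linearIndependent_pair_map_iff, LinearEquiv.dualMap_apply, T.symm_apply_apply, ne_eq,
      h.coeff_along_eq_zero_iff]
    exact hcubic w

theorem FlexAt.map (h : MapsCurve T F G) (hv : FlexAt F v) : FlexAt G (T v) := by
  obtain ⟨hzero, ⟨w, hw⟩, htangent⟩ := hv
  refine ⟨h.eval_eq_zero_iff.2 hzero, ⟨T w, (h.coeff_along_eq_zero_iff v w 1).not.2 hw⟩,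
    T.surjective.forall.2 fun w => ?_⟩
  rw [linearIndependent_pair_map_iff, h.coeff_along_eq_zero_iff, h.coeff_along_eq_zero_iff]
  exact htangent w

end MapsCurve

section Points

variable {F G : Form} {n : ℕ}

theorem ne_iff_linearIndependent_rep {K V : Type*} [Field K] [AddCommGroup V] [Module K V]
    {p q : ℙ K V} : p ≠ q ↔ LinearIndependent K ![p.rep, q.rep] := by
  have h : Projectivization.rep ∘ ![p, q] = ![p.rep, q.rep] := by
    ext i : 1
    fin_cases i <;> rfl
  rw [← Projectivization.independent_pair_iff_ne, Projectivization.independent_iff, h]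

theorem forall_ne_rep_iff {K V : Type*} [Field K] [AddCommGroup V] [Module K V] {p : ℙ K V}
    {P : V → Prop} (hP : ∀ (a : Kˣ) (w : V), P (a • w) → P w) :
    (∀ q : ℙ K V, q ≠ p → P q.rep) ↔ ∀ w, LinearIndependent K ![p.rep, w] → P w := by
  refine ⟨fun h w hw => ?_, fun h q hq => h _ (ne_iff_linearIndependent_rep.1 hq.symm)⟩
  have hw₀ : w ≠ 0 := hw.ne_zero 1
  obtain ⟨a, ha⟩ := Projectivization.exists_smul_eq_mk_rep K w hw₀
  refine hP a w (ha ▸ h _ fun heq => ?_)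
  rw [← heq, ← ha] at hw
  exact (LinearIndependent.pair_iff' (smul_ne_zero a.ne_zero hw₀)).1 hw (a⁻¹ : Kˣ)
    (inv_smul_smul a w)

theorem forall_partialAt_eq_zero_iff (F : Form) (p : Plane) :
    (∀ i, partialAt F p i = 0) ↔ ∀ w, (along F p.rep w).coeff 1 = 0 := by
  simp only [coeff_one_along, partialAt]
  exact ⟨fun h w => Finset.sum_eq_zero fun i _ => mul_eq_zero_of_left (h i) _,
    fun h i => by simpa [Pi.single_apply] using h (Pi.single i 1)⟩

theorem isSingularPoint_iff_rep {p : Plane} : IsSingularPoint F p ↔ SingularAt F p.rep :=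
  and_congr_right fun _ => forall_partialAt_eq_zero_iff F p

theorem isSmoothPoint_iff_rep {p : Plane} :
    IsSmoothPoint F p ↔ MvPolynomial.eval p.rep F = 0 ∧ ∃ w, (along F p.rep w).coeff 1 ≠ 0 := by
  have h := (forall_partialAt_eq_zero_iff F p).not
  push Not at h
  exact and_congr_right fun _ => h

theorem onTangentLine_iff_rep {p q : Plane} :
    OnTangentLine F p q ↔ (along F p.rep q.rep).coeff 1 = 0 := by
  rw [coeff_one_along]
  rfl

theorem three_le_lineMult_iff (F : Form) (p q : Plane) :
    3 ≤ lineMult F p q ↔ ∀ k < 3, (along F p.rep q.rep).coeff k = 0 := by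
  rw [← Polynomial.X_pow_dvd_iff, pow_dvd_iff_le_emultiplicity]
  rfl

theorem lineMult_eq_three_iff (F : Form) (p q : Plane) :
    lineMult F p q = 3 ↔
      (∀ k < 3, (along F p.rep q.rep).coeff k = 0) ∧ (along F p.rep q.rep).coeff 3 ≠ 0 := by
  have h : lineMult F p q = 3 ↔ Polynomial.X ^ 3 ∣ along F p.rep q.rep ∧
      ¬ Polynomial.X ^ (3 + 1) ∣ along F p.rep q.rep := emultiplicity_eq_coe
  rw [h, Polynomial.X_pow_dvd_iff, Polynomial.X_pow_dvd_iff]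
  refine and_congr_right fun hlt => not_congr ⟨fun h4 => h4 3 (by norm_num), fun h3 k hk => ?_⟩
  rcases Nat.lt_succ_iff_lt_or_eq.1 hk with hk | rfl
  exacts [hlt k hk, h3]

theorem quadraticPart_eq (F : Form) (p : Plane) (w : Fin 3 → ℂ) :
    quadraticPart F p w = 2 * (along F p.rep w).coeff 2 :=
  (two_mul_coeff_two_along F p.rep w).symm

theorem isNode_iff_rep {p : Plane} : IsNode F p ↔ NodeAt F p.rep := by
  rw [IsNode, NodeAt, isSingularPoint_iff_rep]
  refine and_congr_right fun _ => ⟨?_, ?_⟩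
  · rintro ⟨l, m, hlm, hquad⟩
    refine ⟨(2⁻¹ : ℂ) • l, m, ?_, fun w => ?_⟩
    · simpa using (LinearIndependent.pair_smul_smul_iff
        (inv_ne_zero (two_ne_zero (α := ℂ))).isUnit isUnit_one).2 hlm
    · rw [LinearMap.smul_apply, smul_eq_mul, mul_assoc, ← hquad, quadraticPart_eq,
        inv_mul_cancel_left₀ two_ne_zero]
  · rintro ⟨l, m, hlm, hquad⟩
    refine ⟨(2 : ℂ) • l, m, ?_, fun w => ?_⟩
    · simpa using (LinearIndependent.pair_smul_smul_iff
        (two_ne_zero (α := ℂ)).isUnit isUnit_one).2 hlm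
    · rw [quadraticPart_eq, hquad, LinearMap.smul_apply, smul_eq_mul, mul_assoc]

theorem SingularAt.forall_lineMult_eq_three_iff {p : Plane} {l : Module.Dual ℂ (Fin 3 → ℂ)}
    (hsing : SingularAt F p.rep) (hquad : ∀ w, l w = 0 → (along F p.rep w).coeff 2 = 0) :
    (∀ q : Plane, q ≠ p → l q.rep = 0 → lineMult F p q = 3) ↔
      ∀ w, LinearIndependent ℂ ![p.rep, w] → l w = 0 → (along F p.rep w).coeff 3 ≠ 0 := by
  have hscale (a : ℂˣ) (w : Fin 3 → ℂ)
      (h : l (a • w) = 0 → (along F p.rep (a • w)).coeff 3 ≠ 0) :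
      l w = 0 → (along F p.rep w).coeff 3 ≠ 0 := by
    simpa [Units.smul_def, coeff_along_smul_right] using h
  rw [← forall_ne_rep_iff hscale]
  refine forall₂_congr fun q _ => imp_congr_right fun hl => ?_
  rw [lineMult_eq_three_iff]
  refine and_iff_right fun k hk => ?_
  interval_cases k
  exacts [by rw [coeff_zero_along, hsing.1], hsing.2 _, hquad _ hl]

theorem isOrdinaryCusp_iff_rep {p : Plane} : IsOrdinaryCusp F p ↔ CuspAt F p.rep := by
  rw [IsOrdinaryCusp, CuspAt, isSingularPoint_iff_rep]
  refine and_congr_right fun hsing => ⟨?_, ?_⟩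
  · rintro ⟨l, hl, hquad, hcubic⟩
    have hquad' (w) : (along F p.rep w).coeff 2 = 2⁻¹ * l w ^ 2 := by
      rw [← hquad, quadraticPart_eq, inv_mul_cancel_left₀ two_ne_zero]
    exact ⟨2⁻¹, l, by norm_num, hl, hquad',
      (hsing.forall_lineMult_eq_three_iff fun w hw => by simp [hquad', hw]).1 hcubic⟩
  · rintro ⟨a, l, ha, hl, hquad, hcubic⟩
    obtain ⟨s, hs⟩ := IsAlgClosed.exists_pow_nat_eq (2 * a) two_pos
    have hs₀ : s ≠ 0 := by
      rintro rfl
      simp [ha] at hs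
    refine ⟨s • l, smul_ne_zero hs₀ hl, fun w => ?_, ?_⟩
    · rw [quadraticPart_eq, hquad, LinearMap.smul_apply, smul_eq_mul, mul_pow, hs, mul_assoc]
    · simp only [LinearMap.smul_apply, smul_eq_zero, hs₀, false_or]
      exact (hsing.forall_lineMult_eq_three_iff fun w hw => by simp [hquad, hw]).2 hcubic

theorem isFlex_iff_rep {p : Plane} : IsFlex F p ↔ FlexAt F p.rep := by
  rw [IsFlex, FlexAt, isSmoothPoint_iff_rep, and_assoc]
  refine and_congr_right fun hzero => and_congr_right fun _ => ?_
  have hscale (a : ℂˣ) (w : Fin 3 → ℂ)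
      (h : (along F p.rep (a • w)).coeff 1 = 0 → (along F p.rep (a • w)).coeff 2 = 0) :
      (along F p.rep w).coeff 1 = 0 → (along F p.rep w).coeff 2 = 0 := by
    simpa [Units.smul_def, coeff_along_smul_right] using h
  rw [← forall_ne_rep_iff hscale]
  refine forall₂_congr fun q _ => ?_
  rw [onTangentLine_iff_rep, three_le_lineMult_iff]
  refine imp_congr_right fun htangent => ⟨fun h => h 2 (by norm_num), fun h k hk => ?_⟩
  interval_cases k
  exacts [by rw [coeff_zero_along, hzero], htangent, h]

theorem exists_mapsCurve_self_rep_mk (hF : F.IsHomogeneous n) {v : Fin 3 → ℂ} (hv : v ≠ 0) :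
    ∃ T, MapsCurve T F F ∧ T v = (Projectivization.mk ℂ v hv).rep := by
  obtain ⟨a, ha⟩ := Projectivization.exists_smul_eq_mk_rep ℂ v hv
  exact ⟨_, mapsCurve_smulOfNeZero hF a.ne_zero, ha⟩

theorem onCurve_mk_iff (hF : F.IsHomogeneous n) {v : Fin 3 → ℂ} (hv : v ≠ 0) :
    OnCurve F (Projectivization.mk ℂ v hv) ↔ MvPolynomial.eval v F = 0 := by
  obtain ⟨T, hT, hrep⟩ := exists_mapsCurve_self_rep_mk hF hv
  rw [OnCurve, ← hrep, hT.eval_eq_zero_iff]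

theorem isNode_mk_iff (hF : F.IsHomogeneous n) {v : Fin 3 → ℂ} (hv : v ≠ 0) :
    IsNode F (Projectivization.mk ℂ v hv) ↔ NodeAt F v := by
  obtain ⟨T, hT, hrep⟩ := exists_mapsCurve_self_rep_mk hF hv
  rw [isNode_iff_rep, ← hrep]
  exact ⟨fun h => by simpa using h.map hT.symm, .map hT⟩

theorem isOrdinaryCusp_mk_iff (hF : F.IsHomogeneous n) {v : Fin 3 → ℂ} (hv : v ≠ 0) :
    IsOrdinaryCusp F (Projectivization.mk ℂ v hv) ↔ CuspAt F v := by
  obtain ⟨T, hT, hrep⟩ := exists_mapsCurve_self_rep_mk hF hv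
  rw [isOrdinaryCusp_iff_rep, ← hrep]
  exact ⟨fun h => by simpa using h.map hT.symm, .map hT⟩

theorem isFlex_mk_iff (hF : F.IsHomogeneous n) {v : Fin 3 → ℂ} (hv : v ≠ 0) :
    IsFlex F (Projectivization.mk ℂ v hv) ↔ FlexAt F v := by
  obtain ⟨T, hT, hrep⟩ := exists_mapsCurve_self_rep_mk hF hv
  rw [isFlex_iff_rep, ← hrep]
  exact ⟨fun h => by simpa using h.map hT.symm, .map hT⟩

theorem onTangentLine_mk_iff (hF : F.IsHomogeneous n) {v w : Fin 3 → ℂ} (hv : v ≠ 0)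
    (hw : w ≠ 0) :
    OnTangentLine F (Projectivization.mk ℂ v hv) (Projectivization.mk ℂ w hw) ↔
      (along F v w).coeff 1 = 0 := by
  obtain ⟨a, ha⟩ := Projectivization.exists_smul_eq_mk_rep ℂ v hv
  obtain ⟨b, hb⟩ := Projectivization.exists_smul_eq_mk_rep ℂ w hw
  have hscale : b • w = (a⁻¹ * b : ℂ) • a • w := by
    rw [Units.smul_def, Units.smul_def, smul_smul, mul_right_comm, Units.inv_mul, one_mul]
  rw [onTangentLine_iff_rep, ← ha, ← hb, hscale, coeff_along_smul_right, mul_eq_zero_iff_left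
    (by simp)]
  exact (mapsCurve_smulOfNeZero hF a.ne_zero).coeff_along_eq_zero_iff v w 1

theorem dependent_mk_iff {K V : Type*} [Field K] [AddCommGroup V] [Module K V] {u v w : V}
    (hu : u ≠ 0) (hv : v ≠ 0) (hw : w ≠ 0) :
    Projectivization.Dependent ![Projectivization.mk K u hu, Projectivization.mk K v hv,
      Projectivization.mk K w hw] ↔ ¬ LinearIndependent K ![u, v, w] := by
  have h₀ : ∀ i, ![u, v, w] i ≠ 0 := by
    intro i
    fin_cases i
    exacts [hu, hv, hw]
  have h : ![Projectivization.mk K u hu, Projectivization.mk K v hv, Projectivization.mk K w hw] =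
      fun i => Projectivization.mk K (![u, v, w] i) (h₀ i) := by
    ext i
    fin_cases i <;> rfl
  rw [h]
  exact ⟨fun hd hi => Projectivization.dependent_iff_not_independent.1 hd (.mk _ _ hi), .mk _ _⟩

theorem dependent_smul {ι K V : Type*} [Field K] [AddCommGroup V] [Module K V] {p : ι → ℙ K V}
    (T : V ≃ₗ[K] V) (h : Projectivization.Dependent p) :
    Projectivization.Dependent fun i => T • p i := by
  obtain ⟨v, hv, hdep⟩ := h
  exact .mk (T ∘ v) (fun i => (LinearEquiv.map_ne_zero_iff T).2 (hv i))
    ((T.toLinearMap.linearIndependent_iff T.ker).not.2 hdep)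

section Map

variable {T : (Fin 3 → ℂ) ≃ₗ[ℂ] (Fin 3 → ℂ)} {p q : Plane}

theorem smul_eq_mk_rep {K V : Type*} [Field K] [AddCommGroup V] [Module K V] (T : V ≃ₗ[K] V)
    (p : ℙ K V) :
    T • p = Projectivization.mk K (T p.rep) ((LinearEquiv.map_ne_zero_iff T).2 p.rep_nonzero) := by
  conv_lhs => rw [← p.mk_rep]
  rfl

theorem OnCurve.map (h : OnCurve F p) (hF : F.IsHomogeneous n) (hT : MapsCurve T F G) :
    OnCurve G (T • p) := by
  rw [smul_eq_mk_rep, onCurve_mk_iff (hT.isHomogeneous hF)]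
  exact hT.eval_eq_zero_iff.2 h

theorem IsNode.map (h : IsNode F p) (hF : F.IsHomogeneous n) (hT : MapsCurve T F G) :
    IsNode G (T • p) := by
  rw [smul_eq_mk_rep, isNode_mk_iff (hT.isHomogeneous hF)]
  exact (isNode_iff_rep.1 h).map hT

theorem IsOrdinaryCusp.map (h : IsOrdinaryCusp F p) (hF : F.IsHomogeneous n)
    (hT : MapsCurve T F G) : IsOrdinaryCusp G (T • p) := by
  rw [smul_eq_mk_rep, isOrdinaryCusp_mk_iff (hT.isHomogeneous hF)]
  exact (isOrdinaryCusp_iff_rep.1 h).map hT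

theorem IsFlex.map (h : IsFlex F p) (hF : F.IsHomogeneous n) (hT : MapsCurve T F G) :
    IsFlex G (T • p) := by
  rw [smul_eq_mk_rep, isFlex_mk_iff (hT.isHomogeneous hF)]
  exact (isFlex_iff_rep.1 h).map hT

theorem OnTangentLine.map (h : OnTangentLine F p q) (hF : F.IsHomogeneous n)
    (hT : MapsCurve T F G) : OnTangentLine G (T • p) (T • q) := by
  rw [smul_eq_mk_rep, smul_eq_mk_rep, onTangentLine_mk_iff (hT.isHomogeneous hF),
    hT.coeff_along_eq_zero_iff]
  exact onTangentLine_iff_rep.1 h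

theorem IsConfiguration.map {p : Fin 7 → Plane} (h : IsConfiguration F p)
    (hT : MapsCurve T F G) : IsConfiguration G fun i => T • p i :=
  have hF := h.quartic.2
  { quartic := hT.isQuartic h.quartic
    distinct := (MulAction.injective T).comp h.distinct
    node := h.node.map hF hT
    cusp₂ := h.cusp₂.map hF hT
    cusp₃ := h.cusp₃.map hF hT
    flex₄ := h.flex₄.map hF hT
    flex₅ := h.flex₅.map hF hT
    mem₆ := h.mem₆.map hF hT
    mem₇ := h.mem₇.map hF hT
    tangent₄ := h.tangent₄.map hF hT
    tangent₅ := h.tangent₅.map hF hT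
    collinear := by
      convert dependent_smul T h.collinear using 1
      ext i : 1
      fin_cases i <;> rfl }

end Map

end Points

section Quartics

theorem eval_single_of_isHomogeneous {R σ : Type*} [CommSemiring R] [DecidableEq σ]
    {F : MvPolynomial σ R} {n : ℕ} (hF : F.IsHomogeneous n) (i : σ) :
    MvPolynomial.eval (Pi.single i 1) F = F.coeff (Finsupp.single i n) := by
  rw [MvPolynomial.eval_eq, Finset.sum_eq_single (Finsupp.single i n)]
  · rw [Finset.prod_eq_one, mul_one]
    intro j hj
    rw [Finset.mem_singleton.1 (Finsupp.support_single_subset hj), Pi.single_eq_same, one_pow]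
  · intro d hd hne
    obtain ⟨j, hj, hji⟩ : ∃ j ∈ d.support, j ≠ i := by
      by_contra! hsupp
      obtain ⟨b, rfl⟩ := Finsupp.support_subset_singleton'.1
        fun j hj => Finset.mem_singleton.2 (hsupp j hj)
      rw [← Finsupp.degree_single i b, hF.degree_eq_sum_deg_support hd] at hne
      exact hne (by simp [Finsupp.degree_apply])
    rw [Finset.prod_eq_zero hj (by rw [Pi.single_eq_of_ne hji, zero_pow (by simpa using hj)]),
      mul_zero]
  · intro h
    rw [MvPolynomial.notMem_support_iff.1 h, zero_mul]

theorem SingularAt.coeff_eq_zero {K σ : Type*} [Field K] [Finite σ] [DecidableEq σ]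
    {F : MvPolynomial σ K} {n : ℕ} (hF : F.IsHomogeneous n) {i : σ}
    (hi : SingularAt F (Pi.single i 1)) {d : σ →₀ ℕ} (hd : n < d i + 2) : F.coeff d = 0 := by
  by_contra hcoeff
  have hdegree : d.degree = n := by_contra fun h => hcoeff (hF.coeff_eq_zero h)
  rw [← Finsupp.single_add_erase i d, map_add, Finsupp.degree_single] at hdegree
  obtain h | h : (d.erase i).degree = 0 ∨ (d.erase i).degree = 1 := by omega
  · rw [Finsupp.degree_eq_zero_iff] at h
    rw [h, map_zero, add_zero] at hdegree
    rw [← Finsupp.single_add_erase i d, h, add_zero, hdegree, ← eval_single_of_isHomogeneous hF]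
      at hcoeff
    exact hcoeff hi.1
  · obtain ⟨j, hj⟩ : ∃ j, d.erase i = Finsupp.single j 1 := (Finsupp.sum_eq_one_iff _).1 h
    have hji : j ≠ i := by
      rintro rfl
      simpa [hj] using Finsupp.erase_same (f := d) (a := j)
    have := Fintype.ofFinite σ
    have hpartial : MvPolynomial.eval (Pi.single i 1) (MvPolynomial.pderiv j F) = 0 := by
      simpa [coeff_one_along, Pi.single_apply] using hi.2 (Pi.single j 1)
    rw [eval_single_of_isHomogeneous hF.pderiv, MvPolynomial.coeff_pderiv, ← hdegree, h,
      Nat.add_sub_cancel, ← hj, Finsupp.single_add_erase, Finsupp.single_eq_of_ne hji,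
      Nat.cast_zero, zero_add, mul_one] at hpartial
    exact hcoeff hpartial

/-- The six monomials are those of degree four with exponents at most two. -/
theorem exists_eval_eq_of_singularAt_single {K : Type*} [Field K] {F : MvPolynomial (Fin 3) K}
    (hF : F.IsHomogeneous 4) (hsing : ∀ i, SingularAt F (Pi.single i 1)) :
    ∃ a b c d e f : K, ∀ v, MvPolynomial.eval v F =
      a * v 1 ^ 2 * v 2 ^ 2 + b * v 0 ^ 2 * v 2 ^ 2 + c * v 0 ^ 2 * v 1 ^ 2 +
        v 0 * v 1 * v 2 * (d * v 0 + e * v 1 + f * v 2) := by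
  let expo : (Fin 3 → ℕ) → Fin 3 →₀ ℕ := Finsupp.equivFunOnFinite.symm
  let S : Finset (Fin 3 → ℕ) :=
    {![0, 2, 2], ![2, 0, 2], ![2, 2, 0], ![2, 1, 1], ![1, 2, 1], ![1, 1, 2]}
  have hsupp : F.support ⊆ S.map Finsupp.equivFunOnFinite.symm.toEmbedding := by
    intro d hd
    have hle (i : Fin 3) : d i ≤ 2 := by
      by_contra! h
      exact MvPolynomial.mem_support_iff.1 hd ((hsing i).coeff_eq_zero hF (by omega))
    have hsum : d 0 + d 1 + d 2 = 4 := by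
      rw [← Fin.sum_univ_three, ← Finsupp.degree_eq_sum]
      exact (hF.degree_eq_sum_deg_support hd).symm
    have hd_eq : ⇑d = ![d 0, d 1, d 2] := by
      ext i
      fin_cases i <;> rfl
    refine Finset.mem_map.2 ⟨d, ?_, by simp⟩
    rw [hd_eq]
    have h₀ := hle 0
    have h₁ := hle 1
    have h₂ := hle 2
    generalize d 0 = d₀, d 1 = d₁, d 2 = d₂ at hsum h₀ h₁ h₂
    obtain rfl : d₂ = 4 - d₀ - d₁ := by omega
    interval_cases d₀ <;> interval_cases d₁ <;> first | omega | simp [S]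
  refine ⟨F.coeff (expo ![0, 2, 2]), F.coeff (expo ![2, 0, 2]), F.coeff (expo ![2, 2, 0]),
    F.coeff (expo ![2, 1, 1]), F.coeff (expo ![1, 2, 1]), F.coeff (expo ![1, 1, 2]), fun v => ?_⟩
  rw [MvPolynomial.eval_eq', Finset.sum_subset hsupp fun d _ hd => by
    rw [MvPolynomial.notMem_support_iff.1 hd, zero_mul], Finset.sum_map]
  simp [S, Fin.prod_univ_three, expo]
  ring

theorem coeff_along_of_forall_eval {K σ : Type*} [Field K] [Infinite K] {F : MvPolynomial σ K}
    {v w : σ → K} {c₀ c₁ c₂ c₃ c₄ : K}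
    (h : ∀ t, MvPolynomial.eval (v + t • w) F =
      c₀ + c₁ * t + c₂ * t ^ 2 + c₃ * t ^ 3 + c₄ * t ^ 4) :
    (along F v w).coeff 1 = c₁ ∧ (along F v w).coeff 2 = c₂ ∧ (along F v w).coeff 3 = c₃ := by
  have hpoly : along F v w = Polynomial.C c₀ + Polynomial.C c₁ * Polynomial.X +
      Polynomial.C c₂ * Polynomial.X ^ 2 + Polynomial.C c₃ * Polynomial.X ^ 3 +
      Polynomial.C c₄ * Polynomial.X ^ 4 :=
    Polynomial.funext fun t => by simp [eval_along, h]
  rw [hpoly]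
  simp [Polynomial.coeff_C]

/-- The two sides differ by the discriminant of the tangent cone on the span of `u` and `w`. -/
theorem CuspAt.sq_polar_eq {K σ : Type*} [Field K] {F : MvPolynomial σ K} {v : σ → K}
    (hv : CuspAt F v) (u w : σ → K) :
    ((along F v (u + w)).coeff 2 - (along F v u).coeff 2 - (along F v w).coeff 2) ^ 2 =
      4 * (along F v u).coeff 2 * (along F v w).coeff 2 := by
  obtain ⟨-, a, l, -, -, hquad, -⟩ := hv
  simp only [hquad, map_add]
  ring

theorem NodeAt.exists_sq_polar_ne {K σ : Type*} [Field K] {F : MvPolynomial σ K} {v : σ → K}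
    (hv : NodeAt F v) : ∃ u w,
    ((along F v (u + w)).coeff 2 - (along F v u).coeff 2 - (along F v w).coeff 2) ^ 2 ≠
      4 * (along F v u).coeff 2 * (along F v w).coeff 2 := by
  obtain ⟨-, l, m, hlm, hquad⟩ := hv
  by_contra! h
  obtain ⟨u, hu⟩ : ∃ u, l u ≠ 0 := DFunLike.ne_iff.1 (hlm.ne_zero 0)
  have hzero : m u • l + (-l u) • m = 0 := by
    ext1 w
    have hw := h u w
    simp only [hquad, map_add] at hw
    have hsq : (m u * l w - l u * m w) ^ 2 = 0 := by linear_combination hw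
    simpa [sub_eq_add_neg] using hsq
  exact hu (neg_eq_zero.1 (LinearIndependent.pair_iff.1 hlm _ _ hzero).2)

theorem linearIndependent_pair_of_ne {ι R M : Type*} [Semiring R] [AddCommMonoid M] [Module R M]
    {v : ι → M} (hv : LinearIndependent R v) {i j : ι} (hij : i ≠ j) :
    LinearIndependent R ![v i, v j] := by
  have h : ![v i, v j] = v ∘ ![i, j] := by
    ext k : 1
    fin_cases k <;> rfl
  rw [h]
  exact hv.comp _ (injective_pair_iff_ne.2 hij)

theorem exists_eval_eq_of_cuspAt_single {K : Type*} [Field K] [Infinite K]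
    {F : MvPolynomial (Fin 3) K} (hF : F.IsHomogeneous 4)
    (h₀ : SingularAt F (Pi.single 0 1)) (h₁ : CuspAt F (Pi.single 1 1))
    (h₂ : CuspAt F (Pi.single 2 1)) :
    ∃ a b c d e f : K, a ≠ 0 ∧ b ≠ 0 ∧ c ≠ 0 ∧ e ^ 2 = 4 * a * c ∧ f ^ 2 = 4 * a * b ∧
      ∀ v, MvPolynomial.eval v F =
        a * v 1 ^ 2 * v 2 ^ 2 + b * v 0 ^ 2 * v 2 ^ 2 + c * v 0 ^ 2 * v 1 ^ 2 +
          v 0 * v 1 * v 2 * (d * v 0 + e * v 1 + f * v 2) := by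
  have hsing (i : Fin 3) : SingularAt F (Pi.single i 1) := by
    fin_cases i
    exacts [h₀, h₁.1, h₂.1]
  have hli (i j : Fin 3) (hij : i ≠ j) :
      LinearIndependent K ![(Pi.single i 1 : Fin 3 → K), Pi.single j 1] :=
    linearIndependent_pair_of_ne (Pi.linearIndependent_single_one (Fin 3) K) hij
  obtain ⟨a, b, c, d, e, f, heval⟩ := exists_eval_eq_of_singularAt_single hF hsing
  have hquad₁ (w : Fin 3 → K) : (along F (Pi.single 1 1) w).coeff 2 =
      a * w 2 ^ 2 + c * w 0 ^ 2 + e * w 0 * w 2 :=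
    (coeff_along_of_forall_eval (c₀ := 0) (c₁ := 0)
      (c₃ := 2 * w 1 * (a * w 2 ^ 2 + c * w 0 ^ 2 + e * w 0 * w 2) +
        w 0 * w 2 * (d * w 0 + f * w 2))
      (c₄ := MvPolynomial.eval w F) fun t => by simp [heval]; ring).2.1
  have hquad₂ (w : Fin 3 → K) : (along F (Pi.single 2 1) w).coeff 2 =
      a * w 1 ^ 2 + b * w 0 ^ 2 + f * w 0 * w 1 :=
    (coeff_along_of_forall_eval (c₀ := 0) (c₁ := 0)
      (c₃ := 2 * w 2 * (a * w 1 ^ 2 + b * w 0 ^ 2 + f * w 0 * w 1) +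
        w 0 * w 1 * (d * w 0 + e * w 1))
      (c₄ := MvPolynomial.eval w F) fun t => by simp [heval]; ring).2.1
  refine ⟨a, b, c, d, e, f, ?_, ?_, ?_, ?_, ?_, heval⟩
  · simpa [hquad₁] using h₁.coeff_two_along_ne_zero hF h₂.1 (hli 1 2 (by decide))
  · simpa [hquad₂] using h₂.coeff_two_along_ne_zero hF h₀ (hli 2 0 (by decide))
  · simpa [hquad₁] using h₁.coeff_two_along_ne_zero hF h₀ (hli 1 0 (by decide))
  · have h := h₁.sq_polar_eq (Pi.single 0 1) (Pi.single 2 1)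
    simp only [hquad₁, Fin.isValue, Pi.add_apply, ne_eq, Fin.reduceEq, not_false_eq_true,
      Pi.single_eq_of_ne, Pi.single_eq_same, zero_add, one_pow, mul_one, add_zero,
      OfNat.ofNat_ne_zero, zero_pow, mul_zero] at h
    linear_combination h
  · have h := h₂.sq_polar_eq (Pi.single 0 1) (Pi.single 1 1)
    simp only [hquad₂, Fin.isValue, Pi.add_apply, ne_eq, one_ne_zero, not_false_eq_true,
      Pi.single_eq_of_ne, Pi.single_eq_same, zero_add, one_pow, mul_one, zero_ne_one, add_zero,
      OfNat.ofNat_ne_zero, zero_pow, mul_zero] at h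
    linear_combination h

end Quartics

section NormalQuartic

variable {K : Type*} [Field K]

/-- The pencil of quartics to which every quartic with a node and two cusps reduces: the double
point lies at `[1:0:0]`, and the cusps at `[0:1:0]` and `[0:0:1]`. -/
def normalQuartic (k : K) : MvPolynomial (Fin 3) K :=
  (MvPolynomial.X 0 * MvPolynomial.X 1 + MvPolynomial.X 0 * MvPolynomial.X 2 +
      MvPolynomial.X 1 * MvPolynomial.X 2) ^ 2 -
    MvPolynomial.C k * MvPolynomial.X 0 ^ 2 * MvPolynomial.X 1 * MvPolynomial.X 2

theorem eval_normalQuartic (k : K) (v : Fin 3 → K) :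
    MvPolynomial.eval v (normalQuartic k) =
      (v 0 * v 1 + v 0 * v 2 + v 1 * v 2) ^ 2 - k * v 0 ^ 2 * v 1 * v 2 := by
  simp [normalQuartic]

theorem isHomogeneous_normalQuartic (k : K) : (normalQuartic k).IsHomogeneous 4 := by
  have hX := MvPolynomial.isHomogeneous_X K (σ := Fin 3)
  exact ((((hX 0).mul (hX 1)).add ((hX 0).mul (hX 2))).add ((hX 1).mul (hX 2)) |>.pow 2).sub
    ((((MvPolynomial.isHomogeneous_C _ k).mul ((hX 0).pow 2)).mul (hX 1)).mul (hX 2))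

theorem normalQuartic_ne_zero (k : K) : normalQuartic k ≠ 0 := by
  intro h
  have heval := eval_normalQuartic k ![0, 1, 1]
  simp [h] at heval

variable [Infinite K]

theorem coeff_along_normalQuartic (k : K) (u w : Fin 3 → K) :
    (along (normalQuartic k) u w).coeff 1 =
        2 * (u 0 * u 1 + u 0 * u 2 + u 1 * u 2) *
          (u 0 * w 1 + u 1 * w 0 + u 0 * w 2 + u 2 * w 0 + u 1 * w 2 + u 2 * w 1) -
        k * (2 * u 0 * w 0 * u 1 * u 2 + u 0 ^ 2 * (w 1 * u 2 + u 1 * w 2)) ∧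
      (along (normalQuartic k) u w).coeff 2 =
        (u 0 * w 1 + u 1 * w 0 + u 0 * w 2 + u 2 * w 0 + u 1 * w 2 + u 2 * w 1) ^ 2 +
          2 * (u 0 * u 1 + u 0 * u 2 + u 1 * u 2) * (w 0 * w 1 + w 0 * w 2 + w 1 * w 2) -
        k * (w 0 ^ 2 * u 1 * u 2 + 2 * u 0 * w 0 * (w 1 * u 2 + u 1 * w 2) +
          u 0 ^ 2 * w 1 * w 2) ∧
      (along (normalQuartic k) u w).coeff 3 =
        2 * (u 0 * w 1 + u 1 * w 0 + u 0 * w 2 + u 2 * w 0 + u 1 * w 2 + u 2 * w 1) *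
          (w 0 * w 1 + w 0 * w 2 + w 1 * w 2) -
        k * (w 0 ^ 2 * (w 1 * u 2 + u 1 * w 2) + 2 * u 0 * w 0 * w 1 * w 2) :=
  coeff_along_of_forall_eval (c₀ := MvPolynomial.eval u (normalQuartic k))
    (c₄ := MvPolynomial.eval w (normalQuartic k)) fun t => by
      simp only [eval_normalQuartic, Pi.add_apply, Pi.smul_apply, smul_eq_mul]
      ring

theorem singularAt_normalQuartic_single (k : K) (i : Fin 3) :
    SingularAt (normalQuartic k) (Pi.single i 1) := by
  refine ⟨?_, fun w => ?_⟩
  · rw [eval_normalQuartic]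
    fin_cases i <;> simp
  · rw [(coeff_along_normalQuartic k _ w).1]
    fin_cases i <;> simp

theorem coeff_two_along_normalQuartic_single_zero (k : K) (w : Fin 3 → K) :
    (along (normalQuartic k) (Pi.single 0 1) w).coeff 2 =
      (w 1 + w 2) ^ 2 - k * w 1 * w 2 := by
  rw [(coeff_along_normalQuartic k _ w).2.1]
  simp [mul_assoc]

theorem mul_sub_four_ne_zero_of_nodeAt {k : K} (h : NodeAt (normalQuartic k) (Pi.single 0 1)) :
    k * (k - 4) ≠ 0 := by
  intro hk
  obtain ⟨u, w, hdisc⟩ := h.exists_sq_polar_ne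
  simp only [coeff_two_along_normalQuartic_single_zero, Pi.add_apply] at hdisc
  exact hdisc (by linear_combination (u 1 * w 2 - u 2 * w 1) ^ 2 * hk)

theorem nodeAt_normalQuartic [IsAlgClosed K] {k : K} (hk : k * (k - 4) ≠ 0) :
    NodeAt (normalQuartic k) (Pi.single 0 1) := by
  obtain ⟨α, hα⟩ : ∃ α : K, α ^ 2 - (k - 2) * α + 1 = 0 := by
    obtain ⟨α, hα⟩ := IsAlgClosed.exists_root
      (Polynomial.X ^ 2 - Polynomial.C (k - 2) * Polynomial.X + 1 : Polynomial K)
      (by rw [show Polynomial.degree _ = 2 by compute_degree!]; decide)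
    exact ⟨α, by simpa using hα⟩
  have hne : k - 2 - 2 * α ≠ 0 := by
    intro h
    exact hk (by linear_combination (k - 2 - 2 * α) * h - 4 * hα)
  let l (c : K) : Module.Dual K (Fin 3 → K) := LinearMap.proj 1 - c • LinearMap.proj 2
  have hl (c : K) (w) : l c w = w 1 - c * w 2 := rfl
  refine ⟨singularAt_normalQuartic_single k 0, l α, l (k - 2 - α), ?_, fun w => ?_⟩
  · refine LinearIndependent.pair_iff.2 fun a b hab => ?_
    have h₁ : a + b = 0 := by simpa [hl] using LinearMap.congr_fun hab (Pi.single 1 1)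
    have h₂ : a * α + b * (k - 2 - α) = 0 := by
      have := LinearMap.congr_fun hab (Pi.single 2 1)
      simp only [LinearMap.add_apply, LinearMap.smul_apply, hl, Fin.isValue, ne_eq, Fin.reduceEq,
        not_false_eq_true, Pi.single_eq_of_ne, Pi.single_eq_same, mul_one, zero_sub, smul_eq_mul,
        mul_neg, neg_sub, LinearMap.zero_apply] at this
      linear_combination -this
    have hb : b = 0 := by
      refine (mul_eq_zero.1 (?_ : b * (k - 2 - 2 * α) = 0)).resolve_right hne
      linear_combination h₂ - α * h₁
    exact ⟨by simpa [hb] using h₁, hb⟩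
  · rw [coeff_two_along_normalQuartic_single_zero, hl, hl]
    linear_combination w 2 ^ 2 * hα

theorem cuspAt_normalQuartic {k : K} (hk : k ≠ 0) {i j : Fin 3} (hi : i ≠ 0) (hj : j ≠ 0)
    (hij : i ≠ j) : CuspAt (normalQuartic k) (Pi.single i 1) := by
  let l : Module.Dual K (Fin 3 → K) :=
    LinearMap.proj (R := K) (φ := fun _ => K) 0 + LinearMap.proj j
  have hl (w) : l w = w 0 + w j := rfl
  have hquad (w) : (along (normalQuartic k) (Pi.single i 1) w).coeff 2 = (w 0 + w j) ^ 2 := by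
    rw [(coeff_along_normalQuartic k _ w).2.1]
    fin_cases i <;> fin_cases j <;> simp at hi hj hij ⊢
  have hcubic (w) : (along (normalQuartic k) (Pi.single i 1) w).coeff 3 =
      2 * (w 0 + w j) * (w 0 * w 1 + w 0 * w 2 + w 1 * w 2) - k * (w 0 ^ 2 * w j) := by
    rw [(coeff_along_normalQuartic k _ w).2.2]
    fin_cases i <;> fin_cases j <;> simp at hi hj hij ⊢
  refine ⟨singularAt_normalQuartic_single k i, 1, l, one_ne_zero, fun h => ?_, fun w => ?_,
    fun w hli hw h => ?_⟩
  · simpa [hl, hj] using LinearMap.congr_fun h (Pi.single 0 1)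
  · rw [hquad, hl, one_mul]
  · rw [hl] at hw
    rw [hcubic, hw, eq_neg_of_add_eq_zero_right hw] at h
    have hw₀ : w 0 = 0 := by simpa [hk] using h
    have hwj : w j = 0 := by simpa [hw₀] using hw
    refine (LinearIndependent.pair_iff' (hli.ne_zero 0)).1 hli (w i) (funext fun n => ?_)
    obtain rfl | rfl | rfl : n = i ∨ n = 0 ∨ n = j := by omega
    · simp
    · simp [hi.symm, hw₀]
    · simp [hij.symm, hwj]

end NormalQuartic

section Frame

variable {F : Form} {n : ℕ}

/-- The points `[1:0:0]`, `[0:1:0]` and `[0:0:1]`. -/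
def coordPoint (i : Fin 3) : Plane :=
  Projectivization.mk ℂ (Pi.single i 1) (by simp)

/-- The rescaled coordinates are `(2 a x, f y, e z)`, in the notation of
`exists_eval_eq_of_cuspAt_single`. -/
theorem exists_mapsCurve_normalQuartic_of_cuspAt_single (hF : F.IsHomogeneous 4)
    (h₀ : SingularAt F (Pi.single 0 1)) (h₁ : CuspAt F (Pi.single 1 1))
    (h₂ : CuspAt F (Pi.single 2 1)) :
    ∃ (S : (Fin 3 → ℂ) ≃ₗ[ℂ] (Fin 3 → ℂ)) (k : ℂ),
      MapsCurve S (normalQuartic k) F ∧ ∀ i, S • coordPoint i = coordPoint i := by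
  obtain ⟨a, b, c, d, e, f, ha, hb, hc, he, hf, heval⟩ :=
    exists_eval_eq_of_cuspAt_single hF h₀ h₁ h₂
  have he₀ : e ≠ 0 := by
    rintro rfl
    simp [ha, hc] at he
  have hf₀ : f ≠ 0 := by
    rintro rfl
    simp [ha, hb] at hf
  let t : Fin 3 → ℂ := ![2 * a, f, e]
  have ht (i) : t i ≠ 0 := by fin_cases i <;> simp [t, ha, he₀, hf₀]
  let S := LinearEquiv.piCongrRight fun i => LinearEquiv.smulOfNeZero ℂ ℂ (t i) (ht i)
  have hS (v) (i) : S v i = t i * v i := rfl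
  refine ⟨S, 2 - 4 * a * d / (e * f),
    mapsCurve_iff.2 ⟨a * e ^ 2 * f ^ 2, by simp [ha, he₀, hf₀], fun v => ?_⟩, fun i => ?_⟩
  · have hdiv : 4 * a * d / (e * f) * (e * f) = 4 * a * d :=
      div_mul_cancel₀ _ (mul_ne_zero he₀ hf₀)
    rw [heval, eval_normalQuartic, hS, hS, hS, show t 0 = 2 * a from rfl,
      show t 1 = f from rfl, show t 2 = e from rfl]
    linear_combination (-a * e ^ 2 * v 0 ^ 2 * v 2 ^ 2) * hf -
      a * f ^ 2 * v 0 ^ 2 * v 1 ^ 2 * he - a * e * f * v 0 ^ 2 * v 1 * v 2 * hdiv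
  · refine (Projectivization.mk_eq_mk_iff' ℂ _ _ _ _).2 ⟨t i, funext fun j => ?_⟩
    change t i * (Pi.single i 1 : Fin 3 → ℂ) j = t j * (Pi.single i 1 : Fin 3 → ℂ) j
    obtain rfl | hij := eq_or_ne j i
    · rfl
    · rw [Pi.single_eq_of_ne hij, mul_zero, mul_zero]

theorem exists_mapsCurve_normalQuartic {p : Fin 3 → Plane} (hF : F.IsHomogeneous 4)
    (hp : Function.Injective p) (h₀ : IsSingularPoint F (p 0)) (h₁ : IsOrdinaryCusp F (p 1))
    (h₂ : IsOrdinaryCusp F (p 2)) :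
    ∃ (S : (Fin 3 → ℂ) ≃ₗ[ℂ] (Fin 3 → ℂ)) (k : ℂ),
      MapsCurve S (normalQuartic k) F ∧ ∀ i, S • coordPoint i = p i := by
  rw [isSingularPoint_iff_rep] at h₀
  rw [isOrdinaryCusp_iff_rep] at h₁ h₂
  have hpair (i j : Fin 3) (hij : i ≠ j) : LinearIndependent ℂ ![(p i).rep, (p j).rep] :=
    ne_iff_linearIndependent_rep.1 (hp.ne hij)
  have hli : LinearIndependent ℂ fun i => (p i).rep := by
    have h := h₁.linearIndependent hF h₂.1 h₀.1 (hpair 1 2 (by decide)) (hpair 1 0 (by decide))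
      (hpair 2 0 (by decide))
    rwa [show ![(p 0).rep, (p 1).rep, (p 2).rep] = fun i => (p i).rep by
      ext i : 1
      fin_cases i <;> rfl] at h
  let U := (basisOfLinearIndependentOfCardEqFinrank hli (by simp)).equivFun.symm
  have hU (i : Fin 3) : U (Pi.single i 1) = (p i).rep := by simp [U]
  have hU' (i : Fin 3) : U.symm (p i).rep = Pi.single i 1 := by rw [← hU, U.symm_apply_apply]
  obtain ⟨G, hG⟩ := exists_mapsCurve U.symm F
  have hsing := h₀.map hG
  have hcusp₁ := h₁.map hG
  have hcusp₂ := h₂.map hG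
  rw [hU'] at hsing hcusp₁ hcusp₂
  obtain ⟨S, k, hS, hcoord⟩ := exists_mapsCurve_normalQuartic_of_cuspAt_single
    (hG.isHomogeneous hF) hsing hcusp₁ hcusp₂
  refine ⟨S.trans U, k, hS.trans hG.symm, fun i => ?_⟩
  calc S.trans U • coordPoint i = U • S • coordPoint i := mul_smul U S _
    _ = U • coordPoint i := by rw [hcoord]
    _ = p i := by
      rw [← (p i).mk_rep]
      simp only [← hU]
      rfl

end Frame

section Parametrization

variable {K : Type*} [Field K] {κ m n : K} {v : Fin 3 → K}

/-- A rational parametrization of the curve `normalQuartic (κ ^ 2) = 0`. It comes from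
`(κ x z) ^ 2 (y / z) = (x y + x z + y z) ^ 2`: on the curve `y / z` is the square of
`m = (x y + x z + y z) / (κ x z)`, and `y / x = κ m - m ^ 2 - 1`. -/
def param (κ m : K) : Fin 3 → K :=
  ![m ^ 2, m ^ 2 * (κ * m - m ^ 2 - 1), κ * m - m ^ 2 - 1]

theorem param_ne_zero (κ m : K) : param κ m ≠ 0 := by
  intro h
  have h₀ : m = 0 := by simpa [param] using congrFun h 0
  simpa [param, h₀] using congrFun h 2

theorem exists_smul_eq_param (hκ : κ ≠ 0) (h : MvPolynomial.eval v (normalQuartic (κ ^ 2)) = 0)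
    (hv : ∀ i, v i ≠ 0) :
    ∃ m, m ≠ 0 ∧ κ * m - m ^ 2 - 1 ≠ 0 ∧ ∃ a : K, a • v = param κ m := by
  have hx := hv 0
  have hy := hv 1
  have hz := hv 2
  rw [eval_normalQuartic] at h
  let m := (v 0 * v 1 + v 0 * v 2 + v 1 * v 2) / (κ * v 0 * v 2)
  have hm : m ^ 2 = v 1 / v 2 := by
    simp only [m]
    field_simp
    linear_combination h
  have hW : κ * m - m ^ 2 - 1 = v 1 / v 0 := by
    rw [hm]
    simp only [m]
    field_simp
    ring
  refine ⟨m, ?_, ?_, v 1 / (v 0 * v 2), ?_⟩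
  · exact ne_zero_pow two_ne_zero (hm ▸ div_ne_zero hy hz)
  · exact hW ▸ div_ne_zero hy hx
  · rw [param, hW, hm]
    ext i
    fin_cases i <;> simp <;> field_simp

theorem exists_forall_ne_eq_zero_of_eval_normalQuartic {k : K}
    (h : MvPolynomial.eval v (normalQuartic k) = 0) (hv : ∃ i, v i = 0) :
    ∃ i, ∀ j ≠ i, v j = 0 := by
  rw [eval_normalQuartic] at h
  have hpair : v 0 = 0 ∧ v 1 = 0 ∨ v 0 = 0 ∧ v 2 = 0 ∨ v 1 = 0 ∧ v 2 = 0 := by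
    obtain ⟨i, hi⟩ := hv
    obtain rfl | rfl | rfl : i = 0 ∨ i = 1 ∨ i = 2 := by omega
    · have h₁₂ : v 1 = 0 ∨ v 2 = 0 := by simpa [hi] using h
      tauto
    · have h₀₂ : v 0 = 0 ∨ v 2 = 0 := by simpa [hi] using h
      tauto
    · have h₀₁ : v 0 = 0 ∨ v 1 = 0 := by simpa [hi] using h
      tauto
  obtain hv' | hv' | hv' := hpair
  exacts [⟨2, by simp [Fin.forall_fin_succ, hv']⟩, ⟨1, by simp [Fin.forall_fin_succ, hv']⟩,
    ⟨0, by simp [Fin.forall_fin_succ, hv']⟩]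

/-- The derivative of `param κ` at `m`. -/
def paramDeriv (κ m : K) : Fin 3 → K :=
  ![2 * m, 2 * m * (κ * m - m ^ 2 - 1) + m ^ 2 * (κ - 2 * m), κ - 2 * m]

theorem linearIndependent_param_paramDeriv [NeZero (2 : K)] (hm : m ≠ 0)
    (hW : κ * m - m ^ 2 - 1 ≠ 0) : LinearIndependent K ![param κ m, paramDeriv κ m] := by
  refine LinearIndependent.pair_iff.2 fun s t h => ?_
  have h₀ := congrFun h 0
  have h₁ := congrFun h 1
  have h₂ := congrFun h 2
  simp only [param, paramDeriv, Pi.add_apply, Pi.smul_apply, smul_eq_mul, Matrix.cons_val,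
    Pi.zero_apply] at h₀ h₁ h₂
  have ht : t * (2 * m * (κ * m - m ^ 2 - 1)) = 0 := by linear_combination h₁ - m ^ 2 * h₂
  have ht₀ : t = 0 := by simpa [hm, hW, two_ne_zero] using ht
  exact ⟨by simpa [ht₀, hm] using h₀, ht₀⟩

theorem sq_eq_sq_of_not_linearIndependent (hm : κ * m - m ^ 2 - 1 ≠ 0)
    (hn : κ * n - n ^ 2 - 1 ≠ 0)
    (h : ¬ LinearIndependent K ![Pi.single 0 1, param κ m, param κ n]) : m ^ 2 = n ^ 2 := by
  have hdet : (Matrix.of ![Pi.single 0 1, param κ m, param κ n]).det = 0 :=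
    by_contra fun hdet => h (Matrix.linearIndependent_rows_of_det_ne_zero hdet)
  have hprod : (κ * m - m ^ 2 - 1) * (κ * n - n ^ 2 - 1) * (m ^ 2 - n ^ 2) = 0 := by
    rw [← hdet, Matrix.det_fin_three]
    simp [param]
    ring
  simpa [hm, hn, sub_eq_zero] using hprod

theorem exists_sq_eq_neg_two_of_param_quadratic [CharZero K]
    (hm : 3 * κ * m ^ 2 - (8 + κ ^ 2) * m + 3 * κ = 0)
    (hn : 3 * κ * n ^ 2 - (8 + κ ^ 2) * n + 3 * κ = 0) (hne : m ≠ n)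
    (h : (κ - 3 * m) ^ 2 = (κ - 3 * n) ^ 2) :
    ∃ r : K, r ^ 2 = -2 ∧ κ ^ 2 = 8 ∧ m = κ * (4 - r) / 12 ∧ n = κ * (4 + r) / 12 := by
  have hne' : m - n ≠ 0 := sub_ne_zero.2 hne
  have hsum : 2 * κ = 3 * (m + n) := by
    have hprod : (m - n) * (2 * κ - 3 * (m + n)) = 0 := by linear_combination -h / 3
    exact sub_eq_zero.1 ((mul_eq_zero.1 hprod).resolve_left hne')
  have hvieta : 3 * κ * (m + n) = 8 + κ ^ 2 := by
    have hprod : (m - n) * (3 * κ * (m + n) - (8 + κ ^ 2)) = 0 := by linear_combination hm - hn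
    exact sub_eq_zero.1 ((mul_eq_zero.1 hprod).resolve_left hne')
  have hκ : κ ^ 2 = 8 := by linear_combination hvieta + κ * hsum
  refine ⟨κ * (κ - 3 * m) / 2, ?_, hκ, ?_, ?_⟩
  · linear_combination ((κ ^ 2 - 6 * κ * m - 1) / 4 + 3 * κ * m / 4) * hκ + (3 * κ / 4) * hm
  · linear_combination (κ - 3 * m) / 24 * hκ
  · linear_combination (-κ + 3 * m) / 24 * hκ - hsum / 3

variable [Infinite K]

theorem coeff_one_along_param_param (κ m n : K) :
    (along (normalQuartic (κ ^ 2)) (param κ m) (param κ n)).coeff 1 =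
      -κ * m ^ 3 * (κ * m - m ^ 2 - 1) * (n - m) ^ 2 *
        ((κ * m - 2) * n ^ 2 + (2 - κ * m) * (κ - 2 * m) * n + m * (κ - 2 * m)) := by
  rw [(coeff_along_normalQuartic _ _ _).1]
  simp only [param, Matrix.cons_val]
  ring

theorem coeff_one_along_param_paramDeriv (κ m : K) :
    (along (normalQuartic (κ ^ 2)) (param κ m) (paramDeriv κ m)).coeff 1 = 0 := by
  rw [(coeff_along_normalQuartic _ _ _).1]
  simp only [param, paramDeriv, Matrix.cons_val]
  ring

theorem coeff_two_along_param_paramDeriv (κ m : K) :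
    (along (normalQuartic (κ ^ 2)) (param κ m) (paramDeriv κ m)).coeff 2 =
      κ * m ^ 4 * (κ * m - m ^ 2 - 1) * (3 * κ * m ^ 2 - (8 + κ ^ 2) * m + 3 * κ) := by
  rw [(coeff_along_normalQuartic _ _ _).2.1]
  simp only [param, paramDeriv, Matrix.cons_val]
  ring

theorem FlexAt.param_quadratic [NeZero (2 : K)] (hκ : κ ≠ 0) (hm : m ≠ 0)
    (hW : κ * m - m ^ 2 - 1 ≠ 0) (h : FlexAt (normalQuartic (κ ^ 2)) (param κ m)) :
    3 * κ * m ^ 2 - (8 + κ ^ 2) * m + 3 * κ = 0 := by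
  have hquad := h.2.2 _ (linearIndependent_param_paramDeriv hm hW)
    (coeff_one_along_param_paramDeriv κ m)
  rw [coeff_two_along_param_paramDeriv] at hquad
  simpa [hκ, hm, hW] using hquad

/-- The tangent at `param κ m` has two residual intersections, with parameters the roots of a
quadratic polynomial. At a flex one of them is `m` itself. -/
theorem eq_sub_three_mul_of_param_quadratic (hκ : κ ≠ 0) (hk : κ ^ 2 ≠ 4) (hm : m ≠ 0)
    (hW : κ * m - m ^ 2 - 1 ≠ 0) (hflex : 3 * κ * m ^ 2 - (8 + κ ^ 2) * m + 3 * κ = 0)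
    (hnm : n ≠ m) (h : (along (normalQuartic (κ ^ 2)) (param κ m) (param κ n)).coeff 1 = 0) :
    n = κ - 3 * m := by
  have hquad : (κ * m - 2) * n ^ 2 + (2 - κ * m) * (κ - 2 * m) * n + m * (κ - 2 * m) = 0 := by
    simpa [coeff_one_along_param_param, hκ, hm, hW, sub_eq_zero, hnm] using h
  have hfactor : (κ * m - 2) * ((n - m) * (n - (κ - 3 * m))) = 0 := by
    linear_combination hquad - m * hflex
  have hlead : κ * m - 2 ≠ 0 := by
    intro hlead
    exact hk (by linear_combination κ * hflex + (2 - 3 * κ * m + κ ^ 2) * hlead)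
  simpa [hlead, sub_ne_zero.2 hnm, sub_eq_zero] using hfactor

theorem exists_eq_mk_param {κ : ℂ} {p : Plane} (hκ : κ ≠ 0)
    (h : OnCurve (normalQuartic (κ ^ 2)) p) (hp : ∀ i, p ≠ coordPoint i) :
    ∃ m, m ≠ 0 ∧ κ * m - m ^ 2 - 1 ≠ 0 ∧
      p = Projectivization.mk ℂ (param κ m) (param_ne_zero κ m) := by
  have hrep : ∀ i, p.rep i ≠ 0 := by
    by_contra! hzero
    obtain ⟨i, hi⟩ := exists_forall_ne_eq_zero_of_eval_normalQuartic h hzero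
    refine hp i (p.mk_rep.symm.trans
      ((Projectivization.mk_eq_mk_iff' ℂ _ _ _ _).2 ⟨p.rep i, funext fun j => ?_⟩))
    obtain rfl | hij := eq_or_ne j i
    · simp
    · simp [hij, hi j hij]
  obtain ⟨m, hm, hW, a, ha⟩ := exists_smul_eq_param hκ h hrep
  refine ⟨m, hm, hW, p.mk_rep.symm.trans (Eq.symm ?_)⟩
  exact (Projectivization.mk_eq_mk_iff' ℂ _ _ _ _).2 ⟨a, ha⟩

end Parametrization

section NormalPoints

variable {r κ : ℂ}

/-- Coordinates of the flexes of `normalQuartic 8`; `r` runs over the square roots of `-2`. -/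
def flexCoords (r : ℂ) : Fin 3 → ℂ := ![9, 8 - 2 * r, 8 + 2 * r]

/-- Coordinates of the remaining intersection of the tangent at `flexCoords r` with the curve. -/
def residualCoords (r : ℂ) : Fin 3 → ℂ := ![1, 2 * r, -2 * r]

/-- Homogeneous coordinates of the seven points of the configuration on `normalQuartic 8`. -/
def normalCoords (r : ℂ) : Fin 7 → Fin 3 → ℂ :=
  ![Pi.single 0 1, Pi.single 1 1, Pi.single 2 1, flexCoords r, flexCoords (-r), residualCoords r,
    residualCoords (-r)]

theorem normalCoords_ne_zero (r : ℂ) (i : Fin 7) : normalCoords r i ≠ 0 := by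
  fin_cases i <;> simp [normalCoords, flexCoords, residualCoords]

/-- The seven points with coordinates `normalCoords r`. -/
def normalPoints (r : ℂ) (i : Fin 7) : Plane :=
  Projectivization.mk ℂ (normalCoords r i) (normalCoords_ne_zero r i)

theorem param_mul_four_sub_div_twelve (hκ : κ ^ 2 = 8) (hr : r ^ 2 = -2) :
    param κ (κ * (4 - r) / 12) = ((7 - 4 * r) / 81) • flexCoords r := by
  have hsq : (κ * (4 - r) / 12) ^ 2 = (7 - 4 * r) / 9 := by
    linear_combination ((4 - r) ^ 2 / 144) * hκ + (1 / 18) * hr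
  have hmul : κ * (κ * (4 - r) / 12) = (8 - 2 * r) / 3 := by
    linear_combination ((4 - r) / 12) * hκ
  rw [param, hsq, hmul, flexCoords, Matrix.smul_vec3]
  congr! 1
  · rw [smul_eq_mul]
    ring
  · simp only [smul_eq_mul]
    congr! 1
    · ring
    · congr! 1
      linear_combination (8 / 81) * hr

theorem param_mul_div_four (hκ : κ ^ 2 = 8) (hr : r ^ 2 = -2) :
    param κ (κ * r / 4) = (-1 : ℂ) • residualCoords r := by
  have hsq : (κ * r / 4) ^ 2 = -1 := by linear_combination r ^ 2 / 16 * hκ + hr / 2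
  have hmul : κ * (κ * r / 4) = 2 * r := by linear_combination r / 4 * hκ
  rw [param, hsq, hmul, residualCoords, Matrix.smul_vec3]
  simp

theorem mk_param_eq_normalPoints (hκ : κ ^ 2 = 8) (hr : r ^ 2 = -2) {m₄ m₅ m₆ m₇ : ℂ}
    (hm₄ : m₄ = κ * (4 - r) / 12) (hm₅ : m₅ = κ * (4 + r) / 12) (hm₆ : m₆ = κ - 3 * m₄)
    (hm₇ : m₇ = κ - 3 * m₅) :
    Projectivization.mk ℂ (param κ m₄) (param_ne_zero κ m₄) = normalPoints r 3 ∧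
      Projectivization.mk ℂ (param κ m₅) (param_ne_zero κ m₅) = normalPoints r 4 ∧
      Projectivization.mk ℂ (param κ m₆) (param_ne_zero κ m₆) = normalPoints r 5 ∧
      Projectivization.mk ℂ (param κ m₇) (param_ne_zero κ m₇) = normalPoints r 6 := by
  have hr' : (-r) ^ 2 = -2 := by rw [neg_sq, hr]
  obtain rfl : m₆ = κ * r / 4 := by rw [hm₆, hm₄]; ring
  obtain rfl : m₇ = κ * -r / 4 := by rw [hm₇, hm₅]; ring
  obtain rfl : m₅ = κ * (4 - -r) / 12 := by rw [hm₅, sub_neg_eq_add]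
  subst hm₄
  simp only [normalPoints, Projectivization.mk_eq_mk_iff', normalCoords]
  exact ⟨⟨_, (param_mul_four_sub_div_twelve hκ hr).symm⟩,
    ⟨_, (param_mul_four_sub_div_twelve hκ hr').symm⟩, ⟨_, (param_mul_div_four hκ hr).symm⟩,
    ⟨_, (param_mul_div_four hκ hr').symm⟩⟩

theorem IsFlex.param_quadratic_and_residual (hκ : κ ^ 2 * (κ ^ 2 - 4) ≠ 0) {p q : Plane}
    {m n : ℂ} (hm : m ≠ 0) (hW : κ * m - m ^ 2 - 1 ≠ 0)
    (hp : p = Projectivization.mk ℂ (param κ m) (param_ne_zero κ m))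
    (hq : q = Projectivization.mk ℂ (param κ n) (param_ne_zero κ n)) (hpq : q ≠ p)
    (hflex : IsFlex (normalQuartic (κ ^ 2)) p) (htan : OnTangentLine (normalQuartic (κ ^ 2)) p q) :
    3 * κ * m ^ 2 - (8 + κ ^ 2) * m + 3 * κ = 0 ∧ n = κ - 3 * m := by
  subst hp hq
  have hF := isHomogeneous_normalQuartic (κ ^ 2)
  have hκ₀ : κ ≠ 0 := ne_zero_pow two_ne_zero (left_ne_zero_of_mul hκ)
  have hquad := FlexAt.param_quadratic hκ₀ hm hW ((isFlex_mk_iff hF _).1 hflex)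
  refine ⟨hquad, eq_sub_three_mul_of_param_quadratic hκ₀
    (sub_ne_zero.1 (right_ne_zero_of_mul hκ)) hm hW hquad ?_
    ((onTangentLine_mk_iff hF _ _).1 htan)⟩
  rintro rfl
  exact hpq rfl

theorem IsConfiguration.exists_eq_normalPoints {p : Fin 7 → Plane}
    (h : IsConfiguration (normalQuartic (κ ^ 2)) p)
    (hcoord : ∀ i : Fin 3, p (i.castLE (by omega)) = coordPoint i) :
    ∃ r : ℂ, r ^ 2 = -2 ∧ κ ^ 2 = 8 ∧ p = normalPoints r := by
  have hp₀ : p 0 = coordPoint 0 := hcoord 0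
  have hκ : κ ^ 2 * (κ ^ 2 - 4) ≠ 0 := mul_sub_four_ne_zero_of_nodeAt
    ((isNode_mk_iff (isHomogeneous_normalQuartic _) _).1 (hp₀ ▸ h.node))
  have hparam {i : Fin 7} (hi : OnCurve (normalQuartic (κ ^ 2)) (p i)) (h3i : 3 ≤ i) :
      ∃ m, m ≠ 0 ∧ κ * m - m ^ 2 - 1 ≠ 0 ∧
        p i = Projectivization.mk ℂ (param κ m) (param_ne_zero κ m) :=
    exists_eq_mk_param (ne_zero_pow two_ne_zero (left_ne_zero_of_mul hκ)) hi
      fun j => hcoord j ▸ h.distinct.ne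
        (lt_of_lt_of_le (show j.castLE _ < 3 from j.isLt) h3i).ne'
  obtain ⟨m₄, hm₄, hW₄, h₄⟩ := hparam h.flex₄.1.1 (by decide)
  obtain ⟨m₅, hm₅, hW₅, h₅⟩ := hparam h.flex₅.1.1 (by decide)
  obtain ⟨m₆, -, hW₆, h₆⟩ := hparam h.mem₆ (by decide)
  obtain ⟨m₇, -, hW₇, h₇⟩ := hparam h.mem₇ (by decide)
  obtain ⟨hquad₄, hres₄⟩ := IsFlex.param_quadratic_and_residual hκ hm₄ hW₄ h₄ h₆
    (h.distinct.ne (by decide)) h.flex₄ h.tangent₄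
  obtain ⟨hquad₅, hres₅⟩ := IsFlex.param_quadratic_and_residual hκ hm₅ hW₅ h₅ h₇
    (h.distinct.ne (by decide)) h.flex₅ h.tangent₅
  have hne : m₄ ≠ m₅ := by
    rintro rfl
    exact h.distinct.ne (by decide) (h₄.trans h₅.symm)
  have hcol := h.collinear
  rw [hp₀, h₆, h₇, coordPoint, dependent_mk_iff] at hcol
  have hsq := sq_eq_sq_of_not_linearIndependent hW₆ hW₇ hcol
  rw [hres₄, hres₅] at hsq
  obtain ⟨r, hr, hκ₈, hr₄, hr₅⟩ := exists_sq_eq_neg_two_of_param_quadratic hquad₄ hquad₅ hne hsq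
  obtain ⟨h₄', h₅', h₆', h₇'⟩ := mk_param_eq_normalPoints hκ₈ hr hr₄ hr₅ hres₄ hres₅
  refine ⟨r, hr, hκ₈, funext fun i => ?_⟩
  fin_cases i
  exacts [hcoord 0, hcoord 1, hcoord 2, h₄.trans h₄', h₅.trans h₅', h₆.trans h₆', h₇.trans h₇']

theorem intCast_add_mul_injective {R : Type*} [CommRing R] [CharZero R] {r : R} {a b c d : ℤ}
    (hr : r ^ 2 = -2) (h : (a : R) + b * r = c + d * r) : a = c ∧ b = d := by
  have hnorm : (a - c) ^ 2 + 2 * (b - d) ^ 2 = 0 := by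
    have hsub : (a : R) - c = (d - b) * r := by linear_combination h
    have hcast : ((a : R) - c) ^ 2 + 2 * (b - d) ^ 2 = 0 := by
      rw [hsub]
      linear_combination (d - b : R) ^ 2 * hr
    exact_mod_cast hcast
  constructor <;> nlinarith [sq_nonneg (a - c), sq_nonneg (b - d)]

/-- The quotient `(z - y) / (x + y + z)` separates the points, with values `0`, `∓ 1`, `± 4 r / 25`
and `∓ 4 r`. -/
theorem normalPoints_injective (hr : r ^ 2 = -2) : Function.Injective (normalPoints r) := by
  let α : Fin 7 → ℤ := ![0, -25, 25, 0, 0, 0, 0]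
  let β : Fin 7 → ℤ := ![0, 0, 0, 4, -4, -100, 100]
  have hαβ : ∀ i j, α i = α j → β i = β j → i = j := by decide
  let s (v : Fin 3 → ℂ) : ℂ := v 0 + v 1 + v 2
  have hquotient (i) : 25 * (normalCoords r i 2 - normalCoords r i 1) =
      (α i + β i * r) * s (normalCoords r i) := by
    fin_cases i <;> simp [normalCoords, flexCoords, residualCoords, α, β, s] <;> ring
  have hs (i) : s (normalCoords r i) ≠ 0 := by
    fin_cases i <;> simp [normalCoords, flexCoords, residualCoords, s] <;> ring_nf <;> norm_num
  intro i j hij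
  obtain ⟨a, ha⟩ := (Projectivization.mk_eq_mk_iff' ℂ _ _ _ _).1 hij
  have hcoord (n) : normalCoords r i n = a * normalCoords r j n := (congrFun ha n).symm
  have hsij : s (normalCoords r i) = a * s (normalCoords r j) := by
    simp only [s, hcoord]
    ring
  have hprod : (α i + β i * r) * s (normalCoords r i) = (α j + β j * r) * s (normalCoords r i) := by
    rw [← hquotient, hcoord, hcoord]
    linear_combination a * hquotient j - (α j + β j * r) * hsij
  obtain ⟨hα, hβ⟩ := intCast_add_mul_injective hr (mul_right_cancel₀ (hs i) hprod)
  exact hαβ i j hα hβ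

theorem coeff_one_along_normalQuartic_flex (hr : r ^ 2 = -2) (w : Fin 3 → ℂ) :
    (along (normalQuartic 8) (flexCoords r) w).coeff 1 =
      432 * ((5 + r) * w 2 + (5 - r) * w 1 - 8 * w 0) := by
  rw [(coeff_along_normalQuartic _ _ _).1]
  simp only [flexCoords, Matrix.cons_val]
  linear_combination
    (-8 * ((17 - 2 * r) * w 2 + (17 + 2 * r) * w 1 + 16 * w 0) + 576 * w 0) * hr

theorem coeff_two_along_normalQuartic_flex (hr : r ^ 2 = -2) (w : Fin 3 → ℂ) :
    (along (normalQuartic 8) (flexCoords r) w).coeff 2 =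
      ((5 + r) * w 2 + (5 - r) * w 1 - 8 * w 0) *
        ((47 - 23 * r) * w 2 + (47 + 23 * r) * w 1 + 40 * w 0) := by
  rw [(coeff_along_normalQuartic _ _ _).2.1]
  simp only [flexCoords, Matrix.cons_val]
  linear_combination (27 * w 2 ^ 2 + 27 * w 1 ^ 2 - 62 * w 2 * w 1 - 8 * w 2 * w 0 -
    8 * w 1 * w 0 + 32 * w 0 ^ 2) * hr

theorem flexAt_normalQuartic (hr : r ^ 2 = -2) :
    FlexAt (normalQuartic 8) (flexCoords r) := by
  refine ⟨?_, ⟨Pi.single 0 1, ?_⟩, fun w _ h => ?_⟩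
  · rw [eval_normalQuartic]
    simp only [flexCoords, Matrix.cons_val]
    linear_combination (864 + 16 * (r ^ 2 + 2)) * hr
  · simp [coeff_one_along_normalQuartic_flex hr]
  · rw [coeff_one_along_normalQuartic_flex hr] at h
    rw [coeff_two_along_normalQuartic_flex hr]
    exact mul_eq_zero_of_left ((mul_eq_zero.1 h).resolve_left (by norm_num)) _

theorem eval_normalQuartic_residual (hr : r ^ 2 = -2) :
    MvPolynomial.eval (residualCoords r) (normalQuartic 8) = 0 := by
  rw [eval_normalQuartic]
  simp only [residualCoords, Matrix.cons_val]
  linear_combination 16 * r ^ 2 * hr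

theorem coeff_one_along_normalQuartic_residual (hr : r ^ 2 = -2) :
    (along (normalQuartic 8) (flexCoords r) (residualCoords r)).coeff 1 = 0 := by
  rw [coeff_one_along_normalQuartic_flex hr]
  simp only [residualCoords, Matrix.cons_val]
  linear_combination (-4 * 432) * hr

theorem isConfiguration_normalQuartic (hr : r ^ 2 = -2) :
    IsConfiguration (normalQuartic 8) (normalPoints r) := by
  have hF := isHomogeneous_normalQuartic (8 : ℂ)
  have hr' : (-r) ^ 2 = -2 := by rw [neg_sq, hr]
  exact {
    quartic := ⟨normalQuartic_ne_zero 8, hF⟩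
    distinct := normalPoints_injective hr
    node := (isNode_mk_iff hF _).2 (nodeAt_normalQuartic (by norm_num))
    cusp₂ := (isOrdinaryCusp_mk_iff hF _).2
      (cuspAt_normalQuartic (j := 2) (by norm_num) (by decide) (by decide) (by decide))
    cusp₃ := (isOrdinaryCusp_mk_iff hF _).2
      (cuspAt_normalQuartic (j := 1) (by norm_num) (by decide) (by decide) (by decide))
    flex₄ := (isFlex_mk_iff hF _).2 (flexAt_normalQuartic hr)
    flex₅ := (isFlex_mk_iff hF _).2 (flexAt_normalQuartic hr')
    mem₆ := (onCurve_mk_iff hF _).2 (eval_normalQuartic_residual hr)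
    mem₇ := (onCurve_mk_iff hF _).2 (eval_normalQuartic_residual hr')
    tangent₄ := (onTangentLine_mk_iff hF _ _).2 (coeff_one_along_normalQuartic_residual hr)
    tangent₅ := (onTangentLine_mk_iff hF _ _).2 (coeff_one_along_normalQuartic_residual hr')
    collinear := by
      refine (dependent_mk_iff _ _ _).2 fun hli => ?_
      have hrel := Fintype.linearIndependent_iff.1 hli ![2, -1, -1] (by
        ext i
        fin_cases i <;> simp [Fin.sum_univ_three, normalCoords, residualCoords]
        norm_num) 0
      simp at hrel }

end NormalPoints

section Shear

/-- The change of coordinates from `normalQuartic 8` to `stdQuartic`. -/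
def shear : (Fin 3 → ℂ) ≃ₗ[ℂ] (Fin 3 → ℂ) where
  toFun v := ![v 2, v 1, v 0 + v 1 + v 2]
  invFun v := ![v 2 - v 1 - v 0, v 1, v 0]
  map_add' u v := by
    ext i
    fin_cases i <;> simp
    ring
  map_smul' a v := by
    ext i
    fin_cases i <;> simp
    ring
  left_inv v := by
    ext i
    fin_cases i <;> simp
    ring
  right_inv v := by
    ext i
    fin_cases i <;> simp
    ring

theorem mapsCurve_shear : MapsCurve shear (normalQuartic 8) stdQuartic := by
  refine mapsCurve_iff.2 ⟨1, one_ne_zero, fun v => ?_⟩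
  simp [eval_normalQuartic, stdQuartic, shear]
  ring

theorem shear_normalCoords (r : ℂ) (i : Fin 7) : shear (normalCoords r i) = stdCoords r i := by
  ext j
  fin_cases i <;> fin_cases j <;>
    simp [shear, normalCoords, stdCoords, flexCoords, residualCoords] <;> ring

theorem shear_smul_normalPoints (r : ℂ) (i : Fin 7) : shear • normalPoints r i = stdPoints r i := by
  simp only [stdPoints, ← shear_normalCoords]
  rfl

end Shear

theorem isConfiguration_stdQuartic {r : ℂ} (hr : r ^ 2 = -2) :
    IsConfiguration stdQuartic (stdPoints r) := by
  simpa only [shear_smul_normalPoints] using (isConfiguration_normalQuartic hr).map mapsCurve_shear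

theorem IsConfiguration.exists_mapsCurve_stdQuartic {F : Form} {p : Fin 7 → Plane}
    (h : IsConfiguration F p) :
    ∃ (T : (Fin 3 → ℂ) ≃ₗ[ℂ] (Fin 3 → ℂ)) (r : ℂ), r ^ 2 = -2 ∧ MapsCurve T F stdQuartic ∧
      ∀ i, T • p i = stdPoints r i := by
  obtain ⟨S, k, hS, hcoord⟩ := exists_mapsCurve_normalQuartic (p := p ∘ Fin.castLE (by omega))
    h.quartic.2 (h.distinct.comp (Fin.castLE_injective _)) h.node.1 h.cusp₂ h.cusp₃
  obtain ⟨κ, rfl⟩ := IsAlgClosed.exists_pow_nat_eq k two_pos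
  obtain ⟨r, hr, hκ, hp⟩ := (h.map hS.symm).exists_eq_normalPoints fun i =>
    (smul_eq_iff_eq_inv_smul S.symm).2 (hcoord i).symm
  rw [hκ] at hS
  refine ⟨S.symm.trans shear, r, hr, hS.symm.trans mapsCurve_shear, fun i => ?_⟩
  calc S.symm.trans shear • p i = shear • S.symm • p i := mul_smul shear S.symm _
    _ = shear • normalPoints r i := by rw [← hp]
    _ = stdPoints r i := shear_smul_normalPoints r i

theorem IsConfiguration.projectivelyEquivalent {F G : Form} {p q : Fin 7 → Plane}
    (hp : IsConfiguration F p) (hq : IsConfiguration G q) : ProjectivelyEquivalent F G := by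
  obtain ⟨T, -, -, hT, -⟩ := hp.exists_mapsCurve_stdQuartic
  obtain ⟨U, -, -, hU, -⟩ := hq.exists_mapsCurve_stdQuartic
  exact ⟨T.trans U.symm, hT.trans hU.symm⟩

end PlaneQuartic

end

theorem mainTheorem3 :
    (∃ (F : PlaneQuartic.Form) (p : Fin 7 → PlaneQuartic.Plane),
      PlaneQuartic.IsConfiguration F p) ∧
    (∀ (F G : PlaneQuartic.Form) (p q : Fin 7 → PlaneQuartic.Plane),
      PlaneQuartic.IsConfiguration F p → PlaneQuartic.IsConfiguration G q →
        PlaneQuartic.ProjectivelyEquivalent F G) ∧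
    (∀ r : ℂ, r ^ 2 = -2 →
      PlaneQuartic.IsConfiguration PlaneQuartic.stdQuartic (PlaneQuartic.stdPoints r)) ∧
    (∀ (F : PlaneQuartic.Form) (p : Fin 7 → PlaneQuartic.Plane),
      PlaneQuartic.IsConfiguration F p →
        ∃ (T : (Fin 3 → ℂ) ≃ₗ[ℂ] (Fin 3 → ℂ)) (r : ℂ), r ^ 2 = -2 ∧
          PlaneQuartic.MapsCurve T F PlaneQuartic.stdQuartic ∧
          ∀ i, T • p i = PlaneQuartic.stdPoints r i) := by
  refine ⟨?_, fun _ _ _ _ hp hq => hp.projectivelyEquivalent hq,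
    fun _ hr => PlaneQuartic.isConfiguration_stdQuartic hr,
    fun _ _ h => h.exists_mapsCurve_stdQuartic⟩
  obtain ⟨r, hr⟩ := IsAlgClosed.exists_pow_nat_eq (-2 : ℂ) two_pos
  exact ⟨_, _, PlaneQuartic.isConfiguration_stdQuartic hr⟩
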